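/- Let $G=(V,E)$ be a finite connected graph, loops and multiple edges being allowed, and let $M$ be the metric graph obtained from $G$ by making every edge an interval of length $1$, with its geodesic distance $d$. A finite set $C\subseteq M$ is called an optimal code if its minimum distance $\delta(C)=\inf\{d(x,y):x,y\in C,\ x\neq y\}$ (with $\inf\varnothing=\infty$) is at least $\delta(D)$ for every $D\subseteq M$ with $|D|=|C|$; it is called optimal and unique up to isometry if moreover every optimal code $D\subseteq M$ with $|D|=|C|$ is of the form $D=g(C)$ for some isometry $g$ of $M$ onto itself. Let $k\geq 1$ be an integer. Let $C_k\subseteq M$ consist of the $k$ points of each edge at the locations $\frac{1}{2k},\frac{3}{2k},\ldots,\frac{2k-1}{2k}$ in a linear parameterization of the edge over $[0,1]$, and let $C'_k\subseteq M$ consist of all vertices together with the $k$ points of each edge at the locations $\frac{1}{k+1},\frac{2}{k+1},\ldots,\frac{k}{k+1}$. (a) The code $C'_k$ is optimal and unique up to isometry if and only if $G$ is a tree or a cycle (a loop at a single vertex and two vertices joined by two parallel edges count as cycles). (b) Suppose that $G$ has at least one edge. The code $C_k$ is optimal and unique up to isometry if and only if $\min_{v\in V}\deg(v)\geq 2$,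 where a loop contributes $2$ to the degree of its vertex. -/

import Mathlib

open scoped ENNReal

section Codes

variable {X : Type*} [EMetricSpace X]

/-- A finite set `C` of points of a metric space is an *optimal code* if no set of the same size has
a larger minimum distance; `Set.einfsep C` is the minimum distance `inf {d(x,y) : x ≠ y in C}`. -/
def IsOptimalCode (C : Set X) : Prop :=
  C.Finite ∧ ∀ D : Set X, D.encard = C.encard → D.einfsep ≤ C.einfsep

/-- `C` is an optimal code, and every optimal code of the same size is the image of `C` under an
isometry of the whole space onto itself. -/
def IsUniqueOptimalCode (C : Set X) : Prop :=
  IsOptimalCode C ∧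
    ∀ D : Set X, D.encard = C.encard → IsOptimalCode D → ∃ g : X ≃ᵢ X, g '' C = D

end Codes

/-- A multigraph with vertex set `V` and edge set `E`; loops and multiple edges are allowed.
The ends of an edge are listed in an arbitrary order, which only serves to fix a linear
parametrization of the edge over `[0,1]`. -/
structure UnitGraph (V E : Type*) where
  /-- the end of the edge at parameter `0` -/
  src : E → V
  /-- the end of the edge at parameter `1` -/
  tgt : E → V

namespace UnitGraph

variable {V E : Type*} (G : UnitGraph V E)

/-! Combinatorial notions. A pair `(e, b)` is the edge `e` traversed forwards (`b = true`) or
backwards (`b = false`). -/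

/-- The vertex at which a traversed edge starts. -/
def start (d : E × Bool) : V := if d.2 then G.src d.1 else G.tgt d.1

/-- The vertex at which a traversed edge ends. -/
def finish (d : E × Bool) : V := if d.2 then G.tgt d.1 else G.src d.1

/-- Adjacency of vertices. -/
def Adj (u v : V) : Prop := ∃ d : E × Bool, G.start d = u ∧ G.finish d = v

/-- A graph is connected if it has a vertex and any two vertices are joined by a walk. -/
def Connected : Prop := Nonempty V ∧ ∀ u v : V, Relation.ReflTransGen G.Adj u v

/-- The degree of a vertex; a loop counts twice. -/
noncomputable def degree (v : V) : ℕ := {e | G.src e = v}.ncard + {e | G.tgt e = v}.ncard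

/-- A cycle of length `n + 1` (a loop if `n = 0`) in the graph: a closed walk which repeats
neither an edge nor a vertex. Addition in `Fin (n + 1)` is cyclic. -/
def IsCycle {n : ℕ} (c : Fin (n + 1) → E × Bool) : Prop :=
  (∀ i, G.finish (c i) = G.start (c (i + 1))) ∧
    Function.Injective (fun i => (c i).1) ∧ Function.Injective (fun i => G.start (c i))

/-- A tree is a connected graph without cycles. -/
def IsTree : Prop :=
  G.Connected ∧ ∀ (n : ℕ) (c : Fin (n + 1) → E × Bool), ¬ G.IsCycle c

/-- The graph is itself a cycle: some cycle runs through all edges and all vertices. -/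
def IsCycleGraph : Prop :=
  ∃ (n : ℕ) (c : Fin (n + 1) → E × Bool), G.IsCycle c ∧
    Function.Surjective (fun i => (c i).1) ∧ Function.Surjective (fun i => G.start (c i))

/-- The points of the metric graph in which every edge is an interval of length one:
the vertices, and the points in the interior of the edges. -/
inductive Point {V E : Type*} (G : UnitGraph V E) : Type _
  | vertex (v : V) : Point G
  | inner (e : E) (t : ℝ) (h0 : 0 < t) (h1 : t < 1) : Point G

/-- The linear parametrization of the (closed) edge `e` over `[0,1]`, with the ends of the interval
glued to the vertices at the ends of `e`. (Only used for `t ∈ [0,1]`.) -/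
noncomputable def pt (e : E) (t : ℝ) : G.Point :=
  if h0 : 0 < t then
    if h1 : t < 1 then .inner e t h0 h1 else .vertex (G.tgt e)
  else .vertex (G.src e)

/-- `G.HasPath x y ℓ`: there is a path of length `ℓ` from `x` to `y` which is the concatenation of
finitely many segments, each of them contained in a closed edge. -/
inductive HasPath {V E : Type*} (G : UnitGraph V E) : G.Point → G.Point → ℝ → Prop
  | refl (x : G.Point) : HasPath G x x 0
  | step (e : E) (s t : ℝ) (hs : s ∈ Set.Icc (0 : ℝ) 1) (ht : t ∈ Set.Icc (0 : ℝ) 1)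
      (y : G.Point) (l : ℝ) (h : HasPath G (G.pt e t) y l) : HasPath G (G.pt e s) y (|s - t| + l)

/-- The geodesic distance: the infimum of the lengths of all paths. -/
noncomputable instance : EDist G.Point :=
  ⟨fun x y => ⨅ (l : ℝ) (_ : G.HasPath x y l), ENNReal.ofReal l⟩

theorem edist_def (x y : G.Point) :
    edist x y = ⨅ (l : ℝ) (_ : G.HasPath x y l), ENNReal.ofReal l := rfl

variable {G}

theorem HasPath.nonneg {x y : G.Point} {l : ℝ} (h : G.HasPath x y l) : 0 ≤ l := by
  induction h with
  | refl => exact le_rfl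
  | step e s t hs ht y l h ih => positivity

theorem HasPath.append {x y z : G.Point} {l m : ℝ} (h : G.HasPath x y l) (h' : G.HasPath y z m) :
    G.HasPath x z (l + m) := by
  induction h with
  | refl => simpa using h'
  | step e s t hs ht y l h ih => rw [add_assoc]; exact .step e s t hs ht _ _ (ih h')

theorem HasPath.reverse {x y : G.Point} {l : ℝ} (h : G.HasPath x y l) : G.HasPath y x l := by
  induction h with
  | refl => exact .refl _
  | step e s t hs ht y l h ih =>
    have := ih.append (.step e t s ht hs _ _ (.refl _))
    rwa [add_zero, abs_sub_comm, add_comm] at this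

theorem HasPath.abs_sub_le {f : G.Point → ℝ}
    (hf : ∀ e, ∀ s ∈ Set.Icc (0 : ℝ) 1, ∀ t ∈ Set.Icc (0 : ℝ) 1,
      |f (G.pt e s) - f (G.pt e t)| ≤ |s - t|)
    {x y : G.Point} {l : ℝ} (h : G.HasPath x y l) : |f x - f y| ≤ l := by
  induction h with
  | refl => simp
  | step e s t hs ht y l h ih =>
    exact (_root_.abs_sub_le _ (f (G.pt e t)) _).trans (add_le_add (hf e s hs t ht) ih)

theorem edist_ne_zero_of_lipschitz {f : G.Point → ℝ}
    (hf : ∀ e, ∀ s ∈ Set.Icc (0 : ℝ) 1, ∀ t ∈ Set.Icc (0 : ℝ) 1,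
      |f (G.pt e s) - f (G.pt e t)| ≤ |s - t|)
    {x y : G.Point} (hxy : f x ≠ f y) : edist x y ≠ 0 := by
  have h : ENNReal.ofReal |f x - f y| ≤ edist x y :=
    le_iInf₂ fun l hl => ENNReal.ofReal_le_ofReal (hl.abs_sub_le hf)
  have h' : 0 < ENNReal.ofReal |f x - f y| :=
    ENNReal.ofReal_pos.2 (abs_pos.2 (sub_ne_zero.2 hxy))
  exact (h'.trans_le h).ne'

theorem edist_comm_aux (x y : G.Point) : edist x y = edist y x :=
  le_antisymm (le_iInf₂ fun l hl => iInf₂_le l hl.reverse)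
    (le_iInf₂ fun l hl => iInf₂_le l hl.reverse)

/-- An interior point of an edge has positive distance from every other point. -/
theorem edist_inner_ne_zero (e : E) (s : ℝ) (h0 : 0 < s) (h1 : s < 1) (y : G.Point)
    (hy : Point.inner e s h0 h1 ≠ y) : edist (Point.inner e s h0 h1 : G.Point) y ≠ 0 := by
  classical
  let f : G.Point → ℝ := fun p => match p with
    | .vertex _ => 0
    | .inner e' t _ _ => if e' = e then max 0 (min s (1 - s) - |t - s|) else 0
  have key : ∀ e', ∀ t ∈ Set.Icc (0 : ℝ) 1,
      f (G.pt e' t) = if e' = e then max 0 (min s (1 - s) - |t - s|) else 0 := by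
    intro e' t ht
    unfold pt
    split_ifs <;> simp only [f] <;> try simp_all
    · have : t = 1 := le_antisymm ht.2 ‹_›
      subst this
      right; linarith [le_abs_self (1 - s)]
    · have : t = 0 := le_antisymm ‹_› ht.1
      subst this
      left; rw [zero_sub, abs_neg]; exact le_abs_self _
  apply edist_ne_zero_of_lipschitz (f := f)
  · intro e' t ht u hu
    rw [key e' t ht, key e' u hu]
    split_ifs
    · refine (abs_max_sub_max_le_max _ _ _ _).trans (max_le (by simp) ?_)
      rw [sub_sub_sub_cancel_left, abs_sub_comm t u]
      refine (abs_abs_sub_abs_le_abs_sub _ _).trans ?_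
      rw [sub_sub_sub_cancel_right]
    · simp
  · have hr : 0 < min s (1 - s) := lt_min h0 (by linarith)
    have hx : f (.inner e s h0 h1) = min s (1 - s) := by simp [f, hr.le]
    rw [hx]
    cases y with
    | vertex v => exact hr.ne'
    | inner e' t h0' h1' =>
      simp only [f]
      split_ifs with he
      · subst he
        have hts : t ≠ s := by rintro rfl; exact hy rfl
        have := abs_pos.2 (sub_ne_zero.2 hts)
        exact (max_lt hr (by linarith)).ne'
      · exact hr.ne'

/-- Distinct vertices have positive distance. -/
theorem edist_vertex_ne_zero (u v : V) (huv : u ≠ v) :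
    edist (Point.vertex u : G.Point) (Point.vertex v) ≠ 0 := by
  classical
  let a : V → ℝ := fun w => if w = u then 0 else 1
  have ha : ∀ w, 0 ≤ a w ∧ a w ≤ 1 := fun w => by simp only [a]; split_ifs <;> norm_num
  let f : G.Point → ℝ := fun p => match p with
    | .vertex w => a w
    | .inner e t _ _ => min (a (G.src e) + t) (a (G.tgt e) + (1 - t))
  have key : ∀ e, ∀ t ∈ Set.Icc (0 : ℝ) 1,
      f (G.pt e t) = min (a (G.src e) + t) (a (G.tgt e) + (1 - t)) := by
    intro e t ht
    have h1 := ha (G.src e)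
    have h2 := ha (G.tgt e)
    unfold pt
    split_ifs with h h' <;> simp only [f]
    · have : t = 1 := le_antisymm ht.2 (not_lt.1 h')
      subst this
      rw [min_eq_right] <;> linarith
    · have : t = 0 := le_antisymm (not_lt.1 h) ht.1
      subst this
      rw [min_eq_left] <;> linarith
  apply edist_ne_zero_of_lipschitz (f := f)
  · intro e s hs t ht
    rw [key e s hs, key e t ht]
    refine (abs_min_sub_min_le_max _ _ _ _).trans (max_le ?_ ?_)
    · rw [add_sub_add_left_eq_sub]
    · rw [add_sub_add_left_eq_sub, sub_sub_sub_cancel_left, abs_sub_comm]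
  · simp [f, a, huv.symm]

theorem eq_of_edist_eq_zero_aux (x y : G.Point) (h : edist x y = 0) : x = y := by
  by_contra hxy
  cases x with
  | inner e s h0 h1 => exact edist_inner_ne_zero e s h0 h1 y hxy h
  | vertex u =>
    cases y with
    | inner e s h0 h1 =>
      rw [edist_comm_aux] at h
      exact edist_inner_ne_zero e s h0 h1 _ (Ne.symm hxy) h
    | vertex v => exact edist_vertex_ne_zero u v (fun huv => hxy (congrArg _ huv)) h

theorem edist_triangle_aux (x y z : G.Point) : edist x z ≤ edist x y + edist y z := by
  simp only [edist_def, ENNReal.iInf_add, ENNReal.add_iInf]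
  refine le_iInf₂ fun m hm => le_iInf₂ fun l hl => ?_
  rw [← ENNReal.ofReal_add hl.nonneg hm.nonneg]
  exact iInf₂_le _ (hl.append hm)

variable (G)

/-- The metric graph, a metric space under the geodesic distance. -/
noncomputable instance : EMetricSpace G.Point where
  edist_self x := by
    refine le_antisymm ((iInf₂_le 0 (.refl x)).trans ?_) zero_le
    simp
  edist_comm := edist_comm_aux
  edist_triangle := edist_triangle_aux
  eq_of_edist_eq_zero := fun {x y} => eq_of_edist_eq_zero_aux x y

/-- The code with `k` points on each edge, at the parameters `1/(2k), 3/(2k), …, (2k-1)/(2k)`. -/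
def codeOdd (k : ℕ) : Set G.Point :=
  {p | ∃ (e : E) (i : ℕ), i < k ∧ p = G.pt e ((2 * i + 1 : ℝ) / (2 * k))}

/-- The code with a point on each vertex and `k` points on each edge, at the parameters
`1/(k+1), 2/(k+1), …, k/(k+1)`. -/
def codeVertex (k : ℕ) : Set G.Point :=
  Set.range Point.vertex ∪
    {p | ∃ (e : E) (i : ℕ), 1 ≤ i ∧ i ≤ k ∧ p = G.pt e ((i : ℝ) / (k + 1))}

end UnitGraph

/-! Write `K = k + 1` for the code with vertices and `K = k` for the other one. Both codes have
minimum distance at least `1/K`, so for optimality and uniqueness it suffices that every `D` of the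
same size with distances at least `1/K` is an isometric image of the code. The basic count is that
an open edge holds at most `K` points of `D`, and at most `K - 1` if one of its ends lies in `D`
(`fiber_ncard_le`).

Trees, part (a): let `S` be the set of vertices in `D`. The edges holding `k + 1` points have both
ends outside `S`. They form a forest there, so they are fewer than the vertices outside `S`, unless
`S` is everything. The size of `D` thus forces `S` to be everything, and then every edge holds
exactly `k` points, in forced positions.

Degrees at least two with a branching vertex, part (b): counting edge ends in `S` shows that a
nonempty `S` would be closed under adjacency and consist of vertices of degree two, so `S` is empty
and every edge holds exactly `k` points. For a traversed edge `d` let `β d` be the distance to its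
first point of `D`, minus `1/(2k)`. The two directions of an edge have `β`-sum at most zero, two
traversed edges leaving the same vertex have sum at least zero. Hence all these estimates are tight
on summation. A vertex of degree at least three then has only zero values, and connectedness spreads
this to the whole graph, so `D` is the given code.

Cycles, both parts: `D` is equally spaced around the circle, and rotations act transitively on such
codes.

Converses: an isometry which sends a vertex to an inner point forces that vertex to have degree two,
as small spheres show. If `G` has a cycle, then `|V| ≤ |E|`, and a subset of `codeOdd (k + 1)`
competes with `codeVertex k`; uniqueness makes all degrees two. If `G` has a leaf, the code point
nearest to it can be moved into the leaf without decreasing the minimum distance, which contradicts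
uniqueness of `codeOdd k`. -/

namespace UnitGraph

/-! ### Traversed edges, Lipschitz maps and elementary distance bounds -/

section Darts

variable {V E : Type*} (G : UnitGraph V E)

/-- The same edge traversed in the opposite direction. -/
def rev (d : E × Bool) : E × Bool := (d.1, !d.2)

/-- The parametrization of an edge in the direction in which it is traversed. -/
noncomputable def dpt (d : E × Bool) (t : ℝ) : G.Point := G.pt d.1 (if d.2 then t else 1 - t)

@[simp] theorem rev_rev (d : E × Bool) : rev (rev d) = d := by simp [rev]

@[simp] theorem rev_fst (d : E × Bool) : (rev d).1 = d.1 := rfl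

theorem rev_ne (d : E × Bool) : rev d ≠ d := by
  intro h
  have := congrArg Prod.snd h
  simp [rev] at this

theorem eq_or_eq_rev {d d' : E × Bool} (h : d.1 = d'.1) : d = d' ∨ d = rev d' := by
  obtain ⟨e, b⟩ := d
  obtain ⟨e', b'⟩ := d'
  simp only at h
  subst h
  cases b <;> cases b' <;> simp [rev]

@[simp] theorem start_rev (d : E × Bool) : G.start (rev d) = G.finish d := by
  obtain ⟨e, b⟩ := d
  cases b <;> simp [rev, start, finish]

@[simp] theorem finish_rev (d : E × Bool) : G.finish (rev d) = G.start d := by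
  obtain ⟨e, b⟩ := d
  cases b <;> simp [rev, start, finish]

@[simp] theorem pt_zero (e : E) : G.pt e 0 = .vertex (G.src e) := by simp [pt]

@[simp] theorem pt_one (e : E) : G.pt e 1 = .vertex (G.tgt e) := by simp [pt]

theorem pt_of_mem {e : E} {t : ℝ} (h0 : 0 < t) (h1 : t < 1) : G.pt e t = .inner e t h0 h1 := by
  simp [pt, h0, h1]

theorem dpt_zero (d : E × Bool) : G.dpt d 0 = .vertex (G.start d) := by
  obtain ⟨e, b⟩ := d
  cases b <;> simp [dpt, start]

theorem dpt_one (d : E × Bool) : G.dpt d 1 = .vertex (G.finish d) := by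
  obtain ⟨e, b⟩ := d
  cases b <;> simp [dpt, finish]

theorem pt_inj {e e' : E} {t t' : ℝ} (h0 : 0 < t) (h1 : t < 1) (h0' : 0 < t') (h1' : t' < 1) :
    G.pt e t = G.pt e' t' ↔ e = e' ∧ t = t' := by
  rw [G.pt_of_mem h0 h1, G.pt_of_mem h0' h1', Point.inner.injEq]

theorem exists_pt_eq (hE : ∀ v : V, ∃ d : E × Bool, G.start d = v) (x : G.Point) :
    ∃ e, ∃ t ∈ Set.Icc (0 : ℝ) 1, G.pt e t = x := by
  cases x with
  | inner e t h0 h1 => exact ⟨e, t, ⟨h0.le, h1.le⟩, G.pt_of_mem h0 h1⟩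
  | vertex v =>
    obtain ⟨⟨e, b⟩, rfl⟩ := hE v
    cases b
    · exact ⟨e, 1, by simp, by simp [start]⟩
    · exact ⟨e, 0, by simp, by simp [start]⟩

theorem edist_pt_le (e : E) {s t : ℝ} (hs : s ∈ Set.Icc (0 : ℝ) 1) (ht : t ∈ Set.Icc (0 : ℝ) 1) :
    edist (G.pt e s) (G.pt e t) ≤ ENNReal.ofReal |s - t| := by
  refine iInf₂_le_of_le (|s - t| + 0) (.step e s t hs ht _ _ (.refl _)) ?_
  rw [add_zero]

theorem edist_dpt_le (d : E × Bool) {s t : ℝ} (hs : s ∈ Set.Icc (0 : ℝ) 1)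
    (ht : t ∈ Set.Icc (0 : ℝ) 1) : edist (G.dpt d s) (G.dpt d t) ≤ ENNReal.ofReal |s - t| := by
  obtain ⟨e, b⟩ := d
  cases b
  · have := G.edist_pt_le e (s := 1 - s) (t := 1 - t) ⟨by linarith [hs.2], by linarith [hs.1]⟩
      ⟨by linarith [ht.2], by linarith [ht.1]⟩
    rwa [sub_sub_sub_cancel_left, abs_sub_comm] at this
  · exact G.edist_pt_le e hs ht

/-- Two points at small distances from a common vertex. -/
theorem edist_dpt_dpt_le {d d' : E × Bool} (h : G.start d = G.start d') {s t : ℝ}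
    (hs : s ∈ Set.Icc (0 : ℝ) 1) (ht : t ∈ Set.Icc (0 : ℝ) 1) :
    edist (G.dpt d s) (G.dpt d' t) ≤ ENNReal.ofReal (s + t) := by
  refine (edist_triangle _ (G.dpt d 0) _).trans ?_
  rw [ENNReal.ofReal_add hs.1 ht.1]
  refine add_le_add ?_ ?_
  · simpa [abs_of_nonneg hs.1] using G.edist_dpt_le d hs (t := 0) (by simp)
  · rw [G.dpt_zero, h, ← G.dpt_zero]
    simpa [abs_of_nonneg ht.1] using G.edist_dpt_le d' (s := 0) (by simp) ht

variable {G}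

/-- A map which does not increase the lengths of segments of edges does not increase distances. -/
theorem edist_map_le {X : Type*} [EMetricSpace X] {f : G.Point → X}
    (hf : ∀ e, ∀ s ∈ Set.Icc (0 : ℝ) 1, ∀ t ∈ Set.Icc (0 : ℝ) 1,
      edist (f (G.pt e s)) (f (G.pt e t)) ≤ ENNReal.ofReal |s - t|) (x y : G.Point) :
    edist (f x) (f y) ≤ edist x y := by
  rw [edist_def G x y]
  refine le_iInf₂ fun l hl => ?_
  induction hl with
  | refl => simp
  | step e s t hs ht y l h ih =>
    rw [ENNReal.ofReal_add (abs_nonneg _) h.nonneg]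
    exact (edist_triangle _ _ _).trans (add_le_add (hf e s hs t ht) ih)

variable (G)

/-- Gluing Lipschitz functions on the edges to a function on the metric graph. -/
theorem exists_profile (a : V → ℝ) (g : E → ℝ → ℝ) (hg : ∀ e, LipschitzWith 1 (g e))
    (h0 : ∀ e, g e 0 = a (G.src e)) (h1 : ∀ e, g e 1 = a (G.tgt e)) :
    ∃ f : G.Point → ℝ, (∀ v, f (.vertex v) = a v) ∧
      (∀ e t h0 h1, f (.inner e t h0 h1) = g e t) ∧
      ∀ x y, ENNReal.ofReal |f x - f y| ≤ edist x y := by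
  let f : G.Point → ℝ := fun p => match p with
    | .vertex w => a w
    | .inner e t _ _ => g e t
  have key : ∀ e, ∀ t ∈ Set.Icc (0 : ℝ) 1, f (G.pt e t) = g e t := by
    intro e t ht
    unfold pt
    split_ifs with h h'
    · rfl
    · obtain rfl : t = 1 := le_antisymm ht.2 (not_lt.1 h')
      exact (h1 e).symm
    · obtain rfl : t = 0 := le_antisymm (not_lt.1 h) ht.1
      exact (h0 e).symm
  refine ⟨f, fun _ => rfl, fun _ _ _ _ => rfl, fun x y => ?_⟩
  have := edist_map_le (f := f) (fun e s hs t ht => by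
    rw [key e s hs, key e t ht]
    simpa [edist_dist, Real.dist_eq] using hg e s t) x y
  rwa [edist_dist, Real.dist_eq] at this

/-- Counting traversed edges makes a loop contribute two automatically, since both of its directions
start at its vertex. -/
theorem degree_eq [Finite E] (v : V) : G.degree v = {d : E × Bool | G.start d = v}.ncard := by
  have : {d : E × Bool | G.start d = v} =
      (fun e => (e, true)) '' {e | G.src e = v} ∪ (fun e => (e, false)) '' {e | G.tgt e = v} := by
    ext ⟨e, b⟩
    cases b <;> simp [start]
  rw [this, Set.ncard_union_eq, Set.ncard_image_of_injective, Set.ncard_image_of_injective, degree]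
  · exact fun _ _ h => congrArg Prod.fst h
  · exact fun _ _ h => congrArg Prod.fst h
  · rw [Set.disjoint_left]
    rintro _ ⟨e, -, rfl⟩ ⟨e', -, h⟩
    simp at h

/-- A property of vertices which is invariant under adjacency holds everywhere or nowhere. -/
theorem Connected.forall_of_exists {G : UnitGraph V E} (hG : G.Connected) {P : V → Prop}
    (hP : ∀ d : E × Bool, P (G.start d) → P (G.finish d)) {v : V} (hv : P v) (w : V) : P w := by
  induction hG.2 v w with
  | refl => exact hv
  | tail _ h ih =>
    obtain ⟨d, rfl, rfl⟩ := h
    exact hP d ih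

theorem Connected.exists_start {G : UnitGraph V E} (hG : G.Connected) [Nonempty E] (v : V) :
    ∃ d : E × Bool, G.start d = v := by
  obtain ⟨e⟩ := ‹Nonempty E›
  exact hG.forall_of_exists (P := fun v => ∃ d : E × Bool, G.start d = v)
    (fun d _ => ⟨rev d, by simp⟩) (v := G.src e) ⟨(e, true), by simp [start]⟩ v

end Darts

end UnitGraph

/-- Optimality comes for free: a strictly better `D` would be an isometric image of `C` and so have
the same minimum distance. -/
theorem isUniqueOptimalCode_of_forall {X : Type*} [EMetricSpace X] {C : Set X} {δ : ℝ≥0∞}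
    (hC : C.Finite) (hδ : δ ≤ C.einfsep)
    (h : ∀ D : Set X, D.encard = C.encard → δ ≤ D.einfsep → ∃ g : X ≃ᵢ X, g '' C = D) :
    IsUniqueOptimalCode C := by
  refine ⟨⟨hC, fun D hD => ?_⟩, fun D hD hopt => ?_⟩
  · by_contra! hlt
    obtain ⟨g, rfl⟩ := h D hD (hδ.trans hlt.le)
    refine hlt.not_ge (Set.le_einfsep fun x hx y hy hxy => ?_)
    rw [← g.edist_eq]
    exact Set.einfsep_le_edist_of_mem (Set.mem_image_of_mem g hx) (Set.mem_image_of_mem g hy)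
      (g.injective.ne hxy)
  · exact h D hD (hδ.trans (hopt.2 C hD.symm))

/-- A code with the size of a unique optimal code and no smaller minimum distance is an isometric image
of it. -/
theorem IsUniqueOptimalCode.exists_image_eq {X : Type*} [EMetricSpace X] {C D : Set X}
    (hC : IsUniqueOptimalCode C) (hD : D.encard = C.encard) (h : C.einfsep ≤ D.einfsep) :
    ∃ g : X ≃ᵢ X, g '' C = D := by
  refine hC.2 D hD ⟨?_, fun D' hD' => (hC.1.2 D' (hD'.trans hD)).trans h⟩
  rw [← Set.encard_lt_top_iff, hD, Set.encard_lt_top_iff]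
  exact hC.1.1

/-! ### Sizes and minimum distances of the two codes -/

namespace UnitGraph

variable {V E : Type*} (G : UnitGraph V E)

theorem odd_mem {k i : ℕ} (hi : i < k) :
    0 < (2 * i + 1 : ℝ) / (2 * k) ∧ (2 * i + 1 : ℝ) / (2 * k) < 1 := by
  have h : (i : ℝ) + 1 ≤ k := by exact_mod_cast hi
  have hk : (0 : ℝ) < k := by linarith [(Nat.cast_nonneg i : (0 : ℝ) ≤ i)]
  exact ⟨by positivity, by rw [div_lt_one (by positivity)]; linarith⟩

theorem frac_mem {k i : ℕ} (h1 : 1 ≤ i) (hi : i ≤ k) :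
    0 < (i : ℝ) / (k + 1) ∧ (i : ℝ) / (k + 1) < 1 := by
  have h : (i : ℝ) ≤ k := by exact_mod_cast hi
  have h' : (1 : ℝ) ≤ i := by exact_mod_cast h1
  exact ⟨by positivity, by rw [div_lt_one (by positivity)]; linarith⟩

theorem codeOdd_eq (k : ℕ) : G.codeOdd k = Set.range fun x : E × Fin k =>
    G.pt x.1 ((2 * (x.2 : ℕ) + 1 : ℝ) / (2 * k)) := by
  ext p
  constructor
  · rintro ⟨e, i, hi, rfl⟩
    exact ⟨(e, ⟨i, hi⟩), rfl⟩
  · rintro ⟨⟨e, i⟩, rfl⟩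
    exact ⟨e, i, i.2, rfl⟩

theorem codeOdd_inner {k : ℕ} {p : G.Point} (hp : p ∈ G.codeOdd k) :
    ∃ e i h0 h1, i < k ∧ p = .inner e ((2 * i + 1 : ℝ) / (2 * k)) h0 h1 := by
  obtain ⟨e, i, hi, rfl⟩ := hp
  exact ⟨e, i, (odd_mem hi).1, (odd_mem hi).2, hi, G.pt_of_mem _ _⟩

theorem vertex_notMem_codeOdd (k : ℕ) (v : V) : .vertex v ∉ G.codeOdd k := by
  intro h
  obtain ⟨e, i, h0, h1, -, h⟩ := G.codeOdd_inner h
  cases h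

theorem encard_codeOdd [Finite E] (k : ℕ) : (G.codeOdd k).encard = (k * Nat.card E : ℕ) := by
  rw [codeOdd_eq, ← Set.image_univ, Function.Injective.encard_image, Set.encard_univ,
    ENat.card_eq_coe_natCard, Nat.card_prod, Nat.card_fin, mul_comm]
  rintro ⟨e, i⟩ ⟨e', i'⟩ h
  rw [pt_inj _ (odd_mem i.2).1 (odd_mem i.2).2 (odd_mem i'.2).1 (odd_mem i'.2).2] at h
  obtain ⟨rfl, h⟩ := h
  have hk : (0 : ℝ) < k := by exact_mod_cast i.pos
  rw [div_left_inj' (by positivity)] at h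
  have : (i : ℕ) = i' := by exact_mod_cast (by linarith : ((i : ℕ) : ℝ) = (i' : ℕ))
  rw [Fin.ext this]

theorem codeVertex_eq (k : ℕ) : G.codeVertex k = Set.range (Sum.elim Point.vertex
    fun x : E × Fin k => G.pt x.1 (((x.2 + 1 : ℕ) : ℝ) / (k + 1))) := by
  rw [Set.Sum.elim_range, codeVertex]
  congr 1
  ext p
  constructor
  · rintro ⟨e, i, hi, hi', rfl⟩
    exact ⟨(e, ⟨i - 1, by omega⟩), by simp [Nat.cast_sub hi]⟩
  · rintro ⟨⟨e, i⟩, rfl⟩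
    exact ⟨e, i + 1, by omega, by omega, rfl⟩

theorem encard_codeVertex [Finite V] [Finite E] (k : ℕ) :
    (G.codeVertex k).encard = (Nat.card V + k * Nat.card E : ℕ) := by
  rw [codeVertex_eq, ← Set.image_univ, Function.Injective.encard_image, Set.encard_univ,
    ENat.card_eq_coe_natCard, Nat.card_sum, Nat.card_prod, Nat.card_fin, mul_comm]
  have hm (i : Fin k) := frac_mem (k := k) (i := i + 1) (by omega) (by omega)
  refine Function.Injective.sumElim (fun v w h => by injection h) ?_ ?_
  · rintro ⟨e, i⟩ ⟨e', i'⟩ h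
    rw [pt_inj _ (hm i).1 (hm i).2 (hm i').1 (hm i').2] at h
    obtain ⟨rfl, h⟩ := h
    rw [div_left_inj' (by positivity)] at h
    have : (i : ℕ) + 1 = i' + 1 := by exact_mod_cast h
    rw [Fin.ext (by omega : (i : ℕ) = i')]
  · rintro v ⟨e, i⟩ h
    rw [G.pt_of_mem (hm i).1 (hm i).2] at h
    cases h

theorem lipschitzWith_sub_abs (r a : ℝ) : LipschitzWith 1 fun t : ℝ => r - |t - a| :=
  LipschitzWith.of_dist_le_mul fun x y => by
    simp only [Real.dist_eq, NNReal.coe_one, one_mul, sub_sub_sub_cancel_left]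
    simpa [abs_sub_comm] using abs_abs_sub_abs_le_abs_sub (y - a) (x - a)

/-- Two inner points whose balls of radius `r` are disjoint intervals in the edges. -/
theorem le_edist_inner_inner {e e' : E} {s t r : ℝ} (hr : 0 ≤ r) (h0 : 0 < s) (h1 : s < 1)
    (h0' : 0 < t) (h1' : t < 1) (hs : r ≤ s ∧ s ≤ 1 - r) (ht : r ≤ t ∧ t ≤ 1 - r)
    (h : e = e' → 2 * r ≤ |s - t|) :
    ENNReal.ofReal (2 * r) ≤ edist (.inner e s h0 h1 : G.Point) (.inner e' t h0' h1') := by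
  classical
  -- A tent of height `r` at `s` and a well of depth `r` at `t`, vanishing at all vertices. The two
  -- do not interfere, and the values at the two points differ by `2 * r`.
  obtain ⟨f, -, hf, hle⟩ := G.exists_profile (fun _ => 0)
    (fun a x => max (if a = e' then min 0 (|x - t| - r) else 0)
      (if a = e then r - |x - s| else -r)) (fun a => by
      have hl : LipschitzWith 1 fun x : ℝ => |x - t| - r :=
        LipschitzWith.of_dist_le_mul fun x y => by
          simpa [Real.dist_eq] using abs_abs_sub_abs_le_abs_sub (x - t) (y - t)
      have h1 : LipschitzWith 1 fun x : ℝ => if a = e' then min 0 (|x - t| - r) else 0 := by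
        split_ifs
        · exact hl.const_min 0
        · exact (LipschitzWith.const _).weaken zero_le
      have h2 : LipschitzWith 1 fun x : ℝ => if a = e then r - |x - s| else -r := by
        split_ifs
        · exact lipschitzWith_sub_abs _ _
        · exact (LipschitzWith.const _).weaken zero_le
      simpa using h1.max h2) (fun a => by
      have h1 : |0 - s| = s := by rw [zero_sub, abs_neg, abs_of_pos h0]
      have h2 : |0 - t| = t := by rw [zero_sub, abs_neg, abs_of_pos h0']
      simp only [h1, h2]
      rw [min_eq_left (by linarith)]
      split_ifs <;> exact max_eq_left (by linarith)) (fun a => by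
      have h1 : |1 - s| = 1 - s := abs_of_pos (by linarith)
      have h2 : |1 - t| = 1 - t := abs_of_pos (by linarith)
      simp only [h1, h2]
      rw [min_eq_left (by linarith)]
      split_ifs <;> exact max_eq_left (by linarith))
  refine le_trans (ENNReal.ofReal_le_ofReal ?_) (hle _ _)
  rw [hf, hf]
  have e1 : max (if e = e' then min 0 (|s - t| - r) else 0)
      (if e = e then r - |s - s| else -r) = r := by
    simp only [if_true, sub_self, abs_zero, sub_zero]
    refine max_eq_right ?_
    split_ifs
    · exact (min_le_left _ _).trans hr
    · exact hr
  have e2 : max (if e' = e' then min 0 (|t - t| - r) else 0)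
      (if e' = e then r - |t - s| else -r) = -r := by
    simp only [if_true, sub_self, abs_zero, zero_sub]
    rw [min_eq_right (by linarith)]
    refine max_eq_left ?_
    split_ifs with he
    · rw [abs_sub_comm]
      linarith [h he.symm]
    · exact le_rfl
  rw [e1, e2]
  exact le_trans (by linarith) (le_abs_self _)

/-- The distance from an inner point to a point in the same edge is at least `r` if their parameters
differ by at least `r`, and the distance to any other point is at least that to the nearest end. -/
theorem le_edist_inner {e : E} {s r : ℝ} (h0 : 0 < s) (h1 : s < 1) (hr : 0 ≤ r) (hs : r ≤ s)
    (hs' : r ≤ 1 - s) (y : G.Point) (hy : ∀ t h0 h1, y = .inner e t h0 h1 → r ≤ |t - s|) :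
    ENNReal.ofReal r ≤ edist (.inner e s h0 h1 : G.Point) y := by
  classical
  -- A single tent of height `r` at `s`, zero outside this edge.
  obtain ⟨f, hfv, hf, hle⟩ := G.exists_profile (fun _ => 0)
    (fun a x => if a = e then max 0 (r - |x - s|) else 0) (fun a => by
      split_ifs
      · exact (lipschitzWith_sub_abs _ _).const_max 0
      · exact (LipschitzWith.const _).weaken zero_le) (fun a => by
      have h1 : |0 - s| = s := by rw [zero_sub, abs_neg, abs_of_pos h0]
      simp only [h1]
      split_ifs
      · exact max_eq_left (by linarith)
      · rfl) (fun a => by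
      have h1 : |1 - s| = 1 - s := abs_of_pos (by linarith)
      simp only [h1]
      split_ifs
      · exact max_eq_left (by linarith)
      · rfl)
  refine le_trans (ENNReal.ofReal_le_ofReal ?_) (hle _ _)
  have e1 : f (.inner e s h0 h1) = r := by simp [hf, hr]
  have e2 : f y = 0 := by
    cases y with
    | vertex v => exact hfv v
    | inner e' t h0 h1 =>
      rw [hf]
      split_ifs with he
      · subst he
        exact max_eq_left (by linarith [hy t h0 h1 rfl])
      · rfl
  rw [e1, e2, sub_zero]
  exact le_abs_self r

/-- A `1`-Lipschitz function which computes the distance from a vertex up to distance `1`. -/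
theorem exists_dist_vertex (v : V) : ∃ f : G.Point → ℝ, f (.vertex v) = 0 ∧
    (∀ w, w ≠ v → f (.vertex w) = 1) ∧
    (∀ e t h0 h1, f (.inner e t h0 h1) < 1 / 2 →
      ∃ d : E × Bool, G.start d = v ∧ G.dpt d (f (.inner e t h0 h1)) = .inner e t h0 h1) ∧
    (∀ d t, G.start d = v → 0 < t → t < 1 / 2 → f (G.dpt d t) = t) ∧
    ∀ x y, ENNReal.ofReal |f x - f y| ≤ edist x y := by
  classical
  let a : V → ℝ := fun w => if w = v then 0 else 1
  have ha : ∀ w, 0 ≤ a w ∧ a w ≤ 1 := fun w => by simp only [a]; split_ifs <;> norm_num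
  -- The distance from `v` that would result if every other vertex were at distance exactly one.
  obtain ⟨f, hfv, hf, hle⟩ := G.exists_profile a
    (fun e t => min (a (G.src e) + t) (a (G.tgt e) + (1 - t))) (fun e => by
      have h1 : LipschitzWith 1 fun t : ℝ => a (G.src e) + t :=
        LipschitzWith.of_dist_le_mul fun x y => by simp
      have h2 : LipschitzWith 1 fun t : ℝ => a (G.tgt e) + (1 - t) :=
        LipschitzWith.of_dist_le_mul fun x y => by
          simp only [Real.dist_eq, NNReal.coe_one, one_mul, add_sub_add_left_eq_sub,
            sub_sub_sub_cancel_left]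
          exact (abs_sub_comm _ _).le
      simpa using h1.min h2) (fun e => by
      rw [add_zero, sub_zero, min_eq_left]
      linarith [ha (G.src e), ha (G.tgt e)]) (fun e => by
      rw [sub_self, add_zero, min_eq_right]
      linarith [ha (G.src e), ha (G.tgt e)])
  have hone : ∀ w, a w < 1 → w = v := fun w hw => by
    by_contra hne
    simp [a, hne] at hw
  have hv : a v = 0 := by simp [a]
  refine ⟨f, by simp [hfv, a], fun w hw => by simp [hfv, a, hw], ?_, ?_, hle⟩
  · intro e t h0 h1 hlt
    rw [hf] at hlt ⊢
    rcases min_choice (a (G.src e) + t) (a (G.tgt e) + (1 - t)) with h | h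
    · rw [h] at hlt ⊢
      have := hone (G.src e) (by linarith)
      refine ⟨(e, true), by simpa [start] using this, ?_⟩
      rw [this, hv, zero_add]
      exact G.pt_of_mem h0 h1
    · rw [h] at hlt ⊢
      have := hone (G.tgt e) (by linarith)
      refine ⟨(e, false), by simpa [start] using this, ?_⟩
      rw [this, hv, zero_add]
      simp [dpt, G.pt_of_mem h0 h1]
  · rintro ⟨e, b⟩ t rfl h0 h1
    cases b
    · have hv : a (G.tgt e) = 0 := hv
      have : G.dpt (e, false) t = .inner e (1 - t) (by linarith) (by linarith) :=
        G.pt_of_mem _ _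
      rw [this, hf, hv, min_eq_right] <;> linarith [ha (G.src e)]
    · have hv : a (G.src e) = 0 := hv
      have : G.dpt (e, true) t = .inner e t h0 (by linarith) := G.pt_of_mem _ _
      rw [this, hf, hv, min_eq_left] <;> linarith [ha (G.tgt e)]

theorem le_einfsep_codeOdd {k : ℕ} (hk : 1 ≤ k) :
    ENNReal.ofReal (1 / k) ≤ (G.codeOdd k).einfsep := by
  refine Set.le_einfsep fun p hp q hq hpq => ?_
  obtain ⟨e, i, h0, h1, hi, rfl⟩ := G.codeOdd_inner hp
  obtain ⟨e', j, h0', h1', hj, rfl⟩ := G.codeOdd_inner hq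
  have hk' : (0 : ℝ) < k := by exact_mod_cast hk
  have hb : ∀ n : ℕ, n < k → 1 / (2 * k : ℝ) ≤ (2 * n + 1 : ℝ) / (2 * k) ∧
      (2 * n + 1 : ℝ) / (2 * k) ≤ 1 - 1 / (2 * k : ℝ) := by
    intro n hn
    have : (n : ℝ) + 1 ≤ k := by exact_mod_cast hn
    constructor
    · gcongr
      linarith [(Nat.cast_nonneg n : (0 : ℝ) ≤ n)]
    · rw [le_sub_iff_add_le, ← add_div, div_le_one (by positivity)]
      linarith
  -- The balls of radius `1/(2k)` around the code points tile every edge.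
  have := G.le_edist_inner_inner (e := e) (e' := e') (r := 1 / (2 * k : ℝ)) (by positivity)
    h0 h1 h0' h1' (hb i hi) (hb j hj) (by
      rintro rfl
      have hij : (i : ℤ) - j ≠ 0 := by
        intro h
        obtain rfl : i = j := by omega
        exact hpq rfl
      have : (1 : ℝ) ≤ |(i : ℝ) - j| := by exact_mod_cast Int.one_le_abs hij
      rw [← sub_div, abs_div, abs_of_pos (by positivity : (0 : ℝ) < 2 * k), ← mul_div_assoc]
      gcongr
      rw [show (2 * i + 1 - (2 * j + 1) : ℝ) = 2 * (i - j) by ring, abs_mul, abs_two]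
      linarith)
  rwa [show 2 * (1 / (2 * k : ℝ)) = 1 / k by field_simp] at this

theorem le_einfsep_codeVertex (k : ℕ) :
    ENNReal.ofReal (1 / (k + 1 : ℕ)) ≤ (G.codeVertex k).einfsep := by
  have key : ∀ (e : E) (i : ℕ), 1 ≤ i → i ≤ k → ∀ q ∈ G.codeVertex k,
      G.pt e ((i : ℝ) / (k + 1)) ≠ q →
      ENNReal.ofReal (1 / (k + 1 : ℕ)) ≤ edist (G.pt e ((i : ℝ) / (k + 1))) q := by
    intro e i hi hi' q hq hne
    have h1 : (1 : ℝ) ≤ i := by exact_mod_cast hi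
    have h2 : (i : ℝ) ≤ k := by exact_mod_cast hi'
    rw [G.pt_of_mem (frac_mem hi hi').1 (frac_mem hi hi').2] at hne ⊢
    push_cast
    refine G.le_edist_inner _ _ (by positivity) (by gcongr) ?_ q ?_
    · rw [le_sub_iff_add_le, ← add_div, div_le_one (by positivity)]
      linarith
    · rintro t h0 h1 rfl
      rcases hq with ⟨v, hv⟩ | ⟨e', j, hj, hj', hq⟩
      · cases hv
      · rw [G.pt_of_mem (frac_mem hj hj').1 (frac_mem hj hj').2, Point.inner.injEq] at hq
        obtain ⟨rfl, rfl⟩ := hq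
        have hij : (j : ℤ) - i ≠ 0 := by
          intro h
          obtain rfl : i = j := by omega
          exact hne rfl
        have : (1 : ℝ) ≤ |(j : ℝ) - i| := by exact_mod_cast Int.one_le_abs hij
        rw [← sub_div, abs_div, abs_of_pos (by positivity : (0 : ℝ) < k + 1)]
        gcongr
  refine Set.le_einfsep fun p hp q hq hpq => ?_
  rcases hp with ⟨v, rfl⟩ | ⟨e, i, hi, hi', rfl⟩
  · rcases hq with ⟨w, rfl⟩ | ⟨e, i, hi, hi', rfl⟩
    · obtain ⟨f, hv, hw, -, -, hle⟩ := G.exists_dist_vertex v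
      refine le_trans (ENNReal.ofReal_le_ofReal ?_) (hle _ _)
      rw [hv, hw w (fun h => hpq (by rw [h]))]
      simp only [zero_sub, abs_neg, abs_one]
      rw [div_le_one (by positivity)]
      exact_mod_cast Nat.le_add_left 1 k
    · rw [edist_comm]
      exact key e i hi hi' _ (Or.inl ⟨v, rfl⟩) hpq.symm
  · exact key e i hi hi' q hq hpq

end UnitGraph

namespace UnitGraph

/-! ### Cycles, circulations and the numbers of vertices and edges -/

section Combinatorics

variable {V E : Type*} (G : UnitGraph V E)

/-- If every traversed edge in `P` can be continued in `P` without going back, then there is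
a cycle. -/
theorem exists_isCycle_of_continue [Finite V] {P : E × Bool → Prop} {d₀ : E × Bool} (h₀ : P d₀)
    (hP : ∀ d, P d → ∃ d', P d' ∧ G.start d' = G.finish d ∧ d' ≠ rev d) :
    ∃ (n : ℕ) (c : Fin (n + 1) → E × Bool), G.IsCycle c := by
  classical
  choose! f hf using hP
  let s : ℕ → E × Bool := fun n => f^[n] d₀
  have hs : ∀ n, s (n + 1) = f (s n) := fun n => Function.iterate_succ_apply' f n d₀
  have hPs : ∀ n, P (s n) := by
    intro n
    induction n with
    | zero => exact h₀
    | succ n ih => rw [hs]; exact (hf _ ih).1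
  have hst : ∀ n, G.start (s (n + 1)) = G.finish (s n) := fun n => by
    rw [hs]; exact (hf _ (hPs n)).2.1
  have hne : ∀ n, s (n + 1) ≠ rev (s n) := fun n => by
    rw [hs]; exact (hf _ (hPs n)).2.2
  have hex : ∃ j, ∃ i < j, G.start (s i) = G.start (s j) := by
    obtain ⟨i, j, hij, h⟩ := Finite.exists_ne_map_eq_of_infinite fun n => G.start (s n)
    rcases hij.lt_or_gt with hlt | hlt
    · exact ⟨j, i, hlt, h⟩
    · exact ⟨i, j, hlt, h.symm⟩
  -- The walk is cut at the first time `j` at which a vertex recurs, so that the vertices before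
  -- time `j` are distinct.
  obtain ⟨i, hij, hi⟩ := Nat.find_spec hex
  set j := Nat.find hex with hj
  have hinj : ∀ a b, a < b → b < j → G.start (s a) ≠ G.start (s b) := fun a b hab hbj h =>
    Nat.find_min hex hbj ⟨a, hab, h⟩
  have hnext : ∀ r : Fin (j - i - 1 + 1), G.start (s (i + (r + 1 : Fin (j - i - 1 + 1)))) =
      G.finish (s (i + r)) := by
    intro r
    rw [← hst, Fin.val_add_one]
    split_ifs with hr
    · subst hr
      simp only [Fin.val_last]
      rw [show i + (j - i - 1) + 1 = j by omega, ← hi, add_zero]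
    · rw [add_assoc]
  refine ⟨j - i - 1, fun r => s (i + r), fun r => (hnext r).symm, ?_, ?_⟩
  · suffices h : ∀ a b : Fin (j - i - 1 + 1), a < b → (s (i + a)).1 ≠ (s (i + b)).1 by
      intro a b hab
      by_contra hne
      rcases lt_or_gt_of_ne hne with hlt | hlt
      · exact h a b hlt hab
      · exact h b a hlt hab.symm
    -- A repeated edge traversed in the same direction repeats a start. In the opposite direction,
    -- distinctness of the starts makes the two traversals consecutive, which is a forbidden
    -- reversal.
    intro a b hab he
    have hab' : (a : ℕ) < b := hab
    have hb := b.2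
    rcases eq_or_eq_rev he with h | h
    · exact hinj (i + a) (i + b) (by omega) (by omega) (by rw [h])
    · have h2 : G.start (s (i + a + 1)) = G.start (s (i + b)) := by
        rw [hst, h, finish_rev]
      have h3 : i + a + 1 = i + b := by
        by_contra hne'
        exact hinj (i + a + 1) (i + b) (by omega) (by omega) h2
      refine hne (i + a) ?_
      rw [h3, h, rev_rev]
  · intro a b hab
    by_contra hne
    rcases lt_or_gt_of_ne hne with hlt | hlt
    · exact hinj (i + a) (i + b) (by have : (a : ℕ) < b := hlt; omega) (by omega) hab
    · exact hinj (i + b) (i + a) (by have : (b : ℕ) < a := hlt; omega) (by omega) hab.symm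

/-- The coboundary map of a graph with real coefficients. -/
def coboundary : (V → ℝ) →ₗ[ℝ] (E → ℝ) where
  toFun f e := f (G.tgt e) - f (G.src e)
  map_add' f g := by ext; simp; ring
  map_smul' r f := by ext; simp; ring

/-- The value of a flow along a traversed edge. -/
def flow (x : E → ℝ) (d : E × Bool) : ℝ := if d.2 then x d.1 else -x d.1

theorem flow_rev (x : E → ℝ) (d : E × Bool) : flow x (rev d) = -flow x d := by
  obtain ⟨e, b⟩ := d
  cases b <;> simp [flow, rev]

theorem flow_coboundary (f : V → ℝ) (d : E × Bool) :
    flow (G.coboundary f) d = f (G.finish d) - f (G.start d) := by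
  obtain ⟨e, b⟩ := d
  cases b <;> simp [flow, coboundary, start, finish]

/-- Constants lie in the kernel of the coboundary map, so its rank is less than `|V| ≤ |E|` and it
is not surjective. A nonzero functional vanishing on its range is a circulation, and a walk along
positive flow never gets stuck nor turns back. -/
theorem exists_isCycle_of_card_le [Finite V] [Finite E] [Nonempty V]
    (h : Nat.card V ≤ Nat.card E) :
    ∃ (n : ℕ) (c : Fin (n + 1) → E × Bool), G.IsCycle c := by
  classical
  have := Fintype.ofFinite V
  have := Fintype.ofFinite E
  rw [Nat.card_eq_fintype_card, Nat.card_eq_fintype_card] at h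
  have hker : 0 < Module.finrank ℝ (LinearMap.ker G.coboundary) := by
    rw [Module.finrank_pos_iff_exists_ne_zero]
    refine ⟨⟨1, ?_⟩, ?_⟩
    · rw [LinearMap.mem_ker]
      ext
      simp [coboundary]
    · intro h0
      have := congrFun (congrArg Subtype.val h0) (Classical.arbitrary V)
      simp at this
  have hrank := G.coboundary.finrank_range_add_finrank_ker
  rw [Module.finrank_fintype_fun_eq_card] at hrank
  have hlt : LinearMap.range G.coboundary < ⊤ := by
    refine lt_top_iff_ne_top.2 fun htop => ?_
    rw [htop, finrank_top, Module.finrank_fintype_fun_eq_card] at hrank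
    omega
  obtain ⟨φ, hφ0, hφ⟩ := Submodule.exists_le_ker_of_lt_top _ hlt
  let x : E → ℝ := fun e => φ (Pi.single e 1)
  have hφx : ∀ g : E → ℝ, φ g = ∑ e, g e * x e := by
    intro g
    conv_lhs => rw [← Finset.univ_sum_single g, map_sum]
    refine Finset.sum_congr rfl fun e _ => ?_
    rw [← smul_eq_mul, ← map_smul, ← Pi.single_smul, smul_eq_mul, mul_one]
  have hcons : ∀ v, ∑ d : E × Bool, (if G.start d = v then flow x d else 0) = 0 := by
    intro v
    have h1 : φ (G.coboundary (Pi.single v 1)) = 0 := hφ ⟨_, rfl⟩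
    rw [hφx] at h1
    refine Eq.trans ?_ (neg_eq_zero.2 h1)
    rw [Fintype.sum_prod_type, ← Finset.sum_neg_distrib]
    refine Finset.sum_congr rfl fun e _ => ?_
    simp only [Fintype.sum_bool, start, flow, coboundary, LinearMap.coe_mk, AddHom.coe_mk,
      Pi.single_apply, if_true, Bool.false_eq_true, if_false]
    split_ifs <;> ring
  have hpos : ∃ d : E × Bool, 0 < flow x d := by
    by_contra! hno
    have hx : ∀ e, x e = 0 := fun e => by
      have h1 := hno (e, true)
      have h2 := hno (e, false)
      simp only [flow, if_true, Bool.false_eq_true, if_false] at h1 h2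
      linarith
    apply hφ0
    ext e
    exact hx e
  obtain ⟨d₀, hd₀⟩ := hpos
  -- By conservation at the end of `d`, the negative flow along `rev d` must be balanced by a
  -- positive one starting there.
  refine G.exists_isCycle_of_continue (P := fun d => 0 < flow x d) hd₀ fun d hd => ?_
  by_contra! hno
  have hle : ∀ d' ∈ Finset.univ, (if G.start d' = G.finish d then flow x d' else 0) ≤ 0 := by
    intro d' _
    split_ifs with hs
    · by_contra! hlt
      have := hno d' hlt hs
      rw [this, flow_rev] at hlt
      linarith
    · exact le_rfl
  have := (Finset.sum_eq_zero_iff_of_nonpos hle).1 (hcons (G.finish d)) (rev d) (Finset.mem_univ _)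
  rw [start_rev, if_pos rfl, flow_rev] at this
  linarith

/-- By connectedness only constants have zero coboundary, so the rank is at least `|V| - 1`.
Coboundaries telescope to zero around the cycle, whereas the indicator of one of its edges does not
sum to zero, so the rank is less than `|E|`. -/
theorem Connected.card_le_of_isCycle [Finite V] [Finite E] {G : UnitGraph V E} (hG : G.Connected)
    {n : ℕ} {c : Fin (n + 1) → E × Bool} (hc : G.IsCycle c) : Nat.card V ≤ Nat.card E := by
  classical
  have := Fintype.ofFinite V
  have := Fintype.ofFinite E
  rw [Nat.card_eq_fintype_card, Nat.card_eq_fintype_card]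
  have hker : Module.finrank ℝ (LinearMap.ker G.coboundary) ≤ 1 := by
    have hle : LinearMap.ker G.coboundary ≤ Submodule.span ℝ {(1 : V → ℝ)} := by
      intro f hf
      rw [LinearMap.mem_ker] at hf
      obtain ⟨v⟩ := hG.1
      rw [Submodule.mem_span_singleton]
      refine ⟨f v, ?_⟩
      ext w
      have := hG.forall_of_exists (P := fun w => f w = f v) (fun d hd => by
        have := flow_coboundary G f d
        rw [hf] at this
        have h0 : flow (0 : E → ℝ) d = 0 := by simp [flow]
        rw [h0] at this
        linarith) (v := v) rfl w
      simp [this]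
    exact (Submodule.finrank_mono hle).trans (finrank_span_le_card _ |>.trans (by simp))
  have hrank := G.coboundary.finrank_range_add_finrank_ker
  rw [Module.finrank_fintype_fun_eq_card] at hrank
  let e₀ := (c 0).1
  have hsum : ∀ f : V → ℝ, ∑ i, flow (G.coboundary f) (c i) = 0 := by
    intro f
    simp only [flow_coboundary, hc.1, Finset.sum_sub_distrib]
    rw [sub_eq_zero]
    exact Equiv.sum_comp (Equiv.addRight (1 : Fin (n + 1))) fun i => f (G.start (c i))
  have hne : LinearMap.range G.coboundary ≠ ⊤ := by
    intro htop
    obtain ⟨f, hf⟩ := LinearMap.range_eq_top.1 htop (Pi.single e₀ 1)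
    have h := hsum f
    rw [hf, Finset.sum_eq_single 0] at h
    · simp only [flow, e₀, Pi.single_eq_same] at h
      split_ifs at h <;> norm_num at h
    · intro i _ hi
      have : (c i).1 ≠ e₀ := hc.2.1.ne hi
      simp [flow, Pi.single_eq_of_ne this]
    · simp
  have hlt := Submodule.finrank_lt hne
  rw [Module.finrank_fintype_fun_eq_card] at hlt
  omega

/-- A forest with at least one vertex has more vertices than edges; here the forest is given as a
set of edges and a set of vertices of an acyclic graph. -/
theorem card_edges_lt [Finite V] [Finite E]
    (hG : ∀ (n : ℕ) (c : Fin (n + 1) → E × Bool), ¬ G.IsCycle c) {S : Set V} {F : Set E}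
    (hS : S.Nonempty) (hsrc : ∀ e ∈ F, G.src e ∈ S) (htgt : ∀ e ∈ F, G.tgt e ∈ S) :
    F.ncard < S.ncard := by
  by_contra! hle
  let H : UnitGraph S F := ⟨fun e => ⟨G.src e, hsrc e e.2⟩, fun e => ⟨G.tgt e, htgt e e.2⟩⟩
  have := hS.to_subtype
  obtain ⟨n, c, hc⟩ := H.exists_isCycle_of_card_le hle
  have hs : ∀ d : F × Bool, G.start (d.1, d.2) = H.start d := by
    rintro ⟨e, b⟩
    cases b <;> rfl
  have hf : ∀ d : F × Bool, G.finish (d.1, d.2) = H.finish d := by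
    rintro ⟨e, b⟩
    cases b <;> rfl
  refine hG n (fun i => ((c i).1, (c i).2)) ⟨fun i => ?_, fun i j h => ?_, fun i j h => ?_⟩
  · rw [hs, hf, hc.1]
  · exact hc.2.1 (Subtype.ext h)
  · simp only [hs] at h
    exact hc.2.2 (Subtype.ext h)

/-- A vertex of degree at least two has a second traversed edge starting there. -/
theorem exists_start_ne [Finite E] {v : V} (hv : 2 ≤ G.degree v) (d : E × Bool) :
    ∃ d', G.start d' = v ∧ d' ≠ d := by
  rw [degree_eq] at hv
  obtain ⟨d', h, hne⟩ := Set.exists_ne_of_one_lt_ncard hv d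
  exact ⟨d', h, hne⟩

/-- A walk that never turns back yields a cycle. This cycle already uses both traversed edges at
each of its vertices, so by connectedness it is the whole graph. -/
theorem Connected.isCycleGraph [Finite V] [Finite E] [Nonempty E] {G : UnitGraph V E}
    (hG : G.Connected) (hdeg : ∀ v, G.degree v = 2) : G.IsCycleGraph := by
  classical
  obtain ⟨e₀⟩ := ‹Nonempty E›
  obtain ⟨n, c, hc⟩ := G.exists_isCycle_of_continue (P := fun _ => True) (d₀ := (e₀, true)) trivial
    fun d _ => by
      obtain ⟨d', h, hne⟩ := G.exists_start_ne (hdeg (G.finish d)).ge (rev d)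
      exact ⟨d', trivial, h, hne⟩
  have hstar : ∀ i d, G.start d = G.start (c (i + 1)) → d = c (i + 1) ∨ d = rev (c i) := by
    intro i d hd
    by_contra! hne
    have hne' : c (i + 1) ≠ rev (c i) := by
      intro h
      have : i + 1 = i := hc.2.1 (by simp [h])
      rw [this] at h
      exact rev_ne _ h.symm
    have hsub : {d, c (i + 1), rev (c i)} ⊆ {d | G.start d = G.start (c (i + 1))} := by
      rintro x (rfl | rfl | rfl)
      · exact hd
      · rfl
      · simp [hc.1]
    have := Set.ncard_le_ncard hsub (Set.toFinite _)
    rw [← degree_eq, hdeg, Set.ncard_eq_three.2 ⟨_, _, _, hne.1, hne.2, hne', rfl⟩] at this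
    omega
  have hstar' : ∀ d, (∃ i, G.start (c i) = G.start d) →
      (∃ i, (c i).1 = d.1) ∧ ∃ i, G.start (c i) = G.finish d := by
    rintro d ⟨i, hi⟩
    have hi' : i = i - 1 + 1 := (sub_add_cancel i 1).symm
    rcases hstar (i - 1) d (by rw [← hi', hi]) with rfl | rfl
    · exact ⟨⟨_, rfl⟩, ⟨_, (hc.1 _).symm⟩⟩
    · exact ⟨⟨_, rfl⟩, ⟨_, (finish_rev _ _).symm⟩⟩
  have hV : ∀ v, ∃ i, G.start (c i) = v := hG.forall_of_exists
    (P := fun v => ∃ i, G.start (c i) = v) (fun d hd => (hstar' d hd).2) ⟨0, rfl⟩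
  exact ⟨n, c, hc, fun e => (hstar' (e, true) (hV _)).1, hV⟩

end Combinatorics

end UnitGraph

/-- Points of a real interval with gaps at least `δ`. -/
theorem separated_finset_real {δ lo : ℝ} (j : ℕ) : ∀ (T : Finset ℝ) (hi : ℝ), T.card = j + 1 →
    (∀ x ∈ T, lo ≤ x ∧ x ≤ hi) → (∀ x ∈ T, ∀ y ∈ T, x ≠ y → δ ≤ |x - y|) →
    lo + j * δ ≤ hi ∧ (hi ≤ lo + j * δ → ∀ i ≤ j, lo + i * δ ∈ T) := by
  classical
  induction j with
  | zero =>
    intro T hi hT hb _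
    obtain ⟨a, rfl⟩ := Finset.card_eq_one.1 hT
    have := hb a (by simp)
    refine ⟨by simp; linarith, fun h i hi => ?_⟩
    obtain rfl : i = 0 := by omega
    simp only [Nat.cast_zero, zero_mul, add_zero, Finset.mem_singleton] at h ⊢
    linarith
  | succ j ih =>
    intro T hi hT hb hsep
    have hne : T.Nonempty := Finset.card_pos.1 (by omega)
    set M := T.max' hne with hM
    have hMT : M ∈ T := T.max'_mem hne
    have hcard : (T.erase M).card = j + 1 := by rw [Finset.card_erase_of_mem hMT, hT]; rfl
    -- Without the maximum `M`, the remaining points lie below `M - δ`.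
    obtain ⟨h1, h2⟩ := ih (T.erase M) (M - δ) hcard (fun x hx => by
      obtain ⟨hxM, hxT⟩ := Finset.mem_erase.1 hx
      have hle := T.le_max' x hxT
      have := hsep M hMT x hxT hxM.symm
      rw [abs_of_nonneg (by linarith)] at this
      exact ⟨(hb x hxT).1, by linarith⟩) (fun x hx y hy =>
        hsep x (Finset.mem_of_mem_erase hx) y (Finset.mem_of_mem_erase hy))
    have hMhi := (hb M hMT).2
    push_cast
    refine ⟨by linarith, fun h i hi => ?_⟩
    rcases hi.lt_or_eq with hlt | rfl
    · exact Finset.mem_of_mem_erase (h2 (by linarith) i (by omega))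
    · have : lo + ((j + 1 : ℕ) : ℝ) * δ = M := by push_cast; linarith
      rwa [this]

namespace UnitGraph

/-! ### Counting the points of a separated set edge by edge -/

section Fibers

variable {V E : Type*} (G : UnitGraph V E)

/-- The parameters of the points of `D` in the interior of an edge. -/
def fiber (D : Set G.Point) (e : E) : Set ℝ := {t | 0 < t ∧ t < 1 ∧ G.pt e t ∈ D}

/-- The vertices in `D`. -/
def vertices (D : Set G.Point) : Set V := {v | .vertex v ∈ D}

variable {G} {D : Set G.Point} {K : ℕ}

theorem fiber_finite (hD : D.Finite) (e : E) : (G.fiber D e).Finite := by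
  refine Set.Finite.of_finite_image (f := G.pt e) (hD.subset ?_) ?_
  · rintro _ ⟨t, ht, rfl⟩
    exact ht.2.2
  · intro s hs t ht h
    exact ((G.pt_inj hs.1 hs.2.1 ht.1 ht.2.1).1 h).2

theorem ncard_eq_sum [Finite V] [Fintype E] (hD : D.Finite) :
    D.ncard = (G.vertices D).ncard + ∑ e, (G.fiber D e).ncard := by
  have hfin : ∀ e, Finite (G.fiber D e) := fun e => (fiber_finite hD e).to_subtype
  have := hD.to_subtype
  have hcard : Nat.card (G.vertices D ⊕ (Σ e, G.fiber D e)) = Nat.card D := by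
    refine Nat.card_congr (Equiv.ofBijective (Sum.elim (fun v => (⟨.vertex v, v.2⟩ : D))
      fun x => (⟨G.pt x.1 x.2, x.2.2.2.2⟩ : D)) ⟨?_, ?_⟩)
    · refine Function.Injective.sumElim ?_ ?_ ?_
      · rintro ⟨v, hv⟩ ⟨w, hw⟩ h
        have := congrArg Subtype.val h
        cases this
        rfl
      · rintro ⟨e, t, ht⟩ ⟨e', t', ht'⟩ h
        have := (G.pt_inj ht.1 ht.2.1 ht'.1 ht'.2.1).1 (congrArg Subtype.val h)
        obtain ⟨rfl, rfl⟩ := this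
        rfl
      · rintro ⟨v, hv⟩ ⟨e, t, ht⟩ h
        have := congrArg Subtype.val h
        simp only [G.pt_of_mem ht.1 ht.2.1] at this
        cases this
    · rintro ⟨x, hx⟩
      cases x with
      | vertex v => exact ⟨Sum.inl ⟨v, hx⟩, rfl⟩
      | inner e t h0 h1 =>
        refine ⟨Sum.inr ⟨e, t, h0, h1, by rwa [G.pt_of_mem h0 h1]⟩, Subtype.ext ?_⟩
        exact G.pt_of_mem h0 h1
  rw [Nat.card_sum, Nat.card_sigma] at hcard
  exact hcard.symm

theorem le_of_edist_le (hsep : ENNReal.ofReal (1 / K) ≤ D.einfsep) {x y : G.Point} (hx : x ∈ D)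
    (hy : y ∈ D) (hxy : x ≠ y) {r : ℝ} (hr : 0 ≤ r) (h : edist x y ≤ ENNReal.ofReal r) :
    1 / K ≤ r :=
  (ENNReal.ofReal_le_ofReal_iff hr).1
    ((hsep.trans (Set.einfsep_le_edist_of_mem hx hy hxy)).trans h)

theorem fiber_sep (hsep : ENNReal.ofReal (1 / K) ≤ D.einfsep) {e : E} {s t : ℝ}
    (hs : s ∈ G.fiber D e) (ht : t ∈ G.fiber D e) (hst : s ≠ t) : 1 / K ≤ |s - t| :=
  le_of_edist_le hsep hs.2.2 ht.2.2
    (fun h => hst ((G.pt_inj hs.1 hs.2.1 ht.1 ht.2.1).1 h).2) (abs_nonneg _)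
    (G.edist_pt_le e ⟨hs.1.le, hs.2.1.le⟩ ⟨ht.1.le, ht.2.1.le⟩)

theorem le_of_src_mem (hsep : ENNReal.ofReal (1 / K) ≤ D.einfsep) {e : E} {t : ℝ}
    (ht : t ∈ G.fiber D e) (h : G.src e ∈ G.vertices D) : 1 / K ≤ t := by
  refine le_of_edist_le hsep ht.2.2 h ?_ ht.1.le ?_
  · rw [G.pt_of_mem ht.1 ht.2.1]
    exact fun h => by cases h
  · rw [← G.pt_zero]
    refine (G.edist_pt_le e ⟨ht.1.le, ht.2.1.le⟩ (by simp)).trans ?_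
    rw [sub_zero, abs_of_pos ht.1]

theorem le_of_tgt_mem (hsep : ENNReal.ofReal (1 / K) ≤ D.einfsep) {e : E} {t : ℝ}
    (ht : t ∈ G.fiber D e) (h : G.tgt e ∈ G.vertices D) : t ≤ 1 - 1 / K := by
  have h0 : 0 ≤ 1 - t := by linarith [ht.2.1]
  have := le_of_edist_le hsep ht.2.2 h ?_ h0 ?_
  · linarith
  · rw [G.pt_of_mem ht.1 ht.2.1]
    exact fun h => by cases h
  · rw [← G.pt_one]
    refine (G.edist_pt_le e ⟨ht.1.le, ht.2.1.le⟩ (by simp)).trans ?_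
    rw [abs_sub_comm, abs_of_nonneg h0]

/-- Points of `D` in an open edge with parameters in `[lo, hi]`. -/
theorem fiber_bound (hD : D.Finite) (hsep : ENNReal.ofReal (1 / K) ≤ D.einfsep) (e : E) {j : ℕ}
    (hj : (G.fiber D e).ncard = j + 1) {lo hi : ℝ}
    (hb : ∀ t ∈ G.fiber D e, lo ≤ t ∧ t ≤ hi) :
    lo + j * (1 / K) ≤ hi ∧ (hi ≤ lo + j * (1 / K) →
      ∀ i ≤ j, G.pt e (lo + i * (1 / K)) ∈ D) := by
  have hf := fiber_finite hD e
  have := separated_finset_real (δ := 1 / K) (lo := lo) j hf.toFinset hi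
    (by rw [← hj, Set.ncard_eq_toFinset_card _ hf]) (by simpa using hb)
    (fun x hx y hy => fiber_sep hsep (by simpa using hx) (by simpa using hy))
  refine ⟨this.1, fun h i hi => ?_⟩
  have := this.2 h i hi
  rw [Set.Finite.mem_toFinset] at this
  exact this.2.2

theorem exists_fiber_bounds (hD : D.Finite) {e : E} (hne : (G.fiber D e).Nonempty) :
    ∃ a ∈ G.fiber D e, ∃ b ∈ G.fiber D e, ∀ t ∈ G.fiber D e, a ≤ t ∧ t ≤ b := by
  have hf := fiber_finite hD e
  obtain ⟨a, ha, ha'⟩ := hf.exists_minimal hne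
  obtain ⟨b, hb, hb'⟩ := hf.exists_maximal hne
  exact ⟨a, ha, b, hb, fun t ht => ⟨le_of_not_gt fun h => absurd (ha' ht h.le) (not_le.2 h),
    le_of_not_gt fun h => absurd (hb' ht h.le) (not_le.2 h)⟩⟩

/-- If there are `j + 1` points, the extreme ones are at least `j / K` apart within an open interval
of length one, so `j < K`. An end in `D` keeps its distance and costs another `1 / K`. -/
theorem fiber_ncard_le (hK : 1 ≤ K) (hD : D.Finite) (hsep : ENNReal.ofReal (1 / K) ≤ D.einfsep)
    (e : E) : (G.fiber D e).ncard ≤ K ∧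
      ((G.src e ∈ G.vertices D ∨ G.tgt e ∈ G.vertices D) → (G.fiber D e).ncard + 1 ≤ K) := by
  have hK' : (0 : ℝ) < K := by exact_mod_cast hK
  obtain h0 | ⟨j, hj⟩ := Nat.eq_zero_or_eq_succ_pred (G.fiber D e).ncard |>.imp_right
    fun h => (⟨_, h⟩ : ∃ j, (G.fiber D e).ncard = j + 1)
  · rw [h0]
    exact ⟨by omega, fun _ => by omega⟩
  · obtain ⟨a, ha, b, hb, hab⟩ := exists_fiber_bounds hD
      (Set.nonempty_of_ncard_ne_zero (by omega : (G.fiber D e).ncard ≠ 0))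
    have h := (fiber_bound hD hsep e hj hab).1
    rw [mul_one_div] at h
    rw [hj]
    constructor
    · have h1 : (j : ℝ) / K < 1 := by linarith [ha.1, hb.2.1]
      rw [div_lt_one hK'] at h1
      have : j < K := by exact_mod_cast h1
      omega
    · intro hor
      have h1 : (j : ℝ) / K + 1 / K < 1 := by
        rcases hor with hs | ht
        · linarith [le_of_src_mem hsep ha hs, hb.2.1]
        · linarith [le_of_tgt_mem hsep hb ht, ha.1]
      rw [← add_div, div_lt_one hK'] at h1
      have : j + 1 < K := by exact_mod_cast h1
      omega

end Fibers

/-! ### Uniqueness of the code with vertices on a tree -/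

section Forest

variable {V E : Type*} {G : UnitGraph V E}

/-- In a forest the code on the vertices and the inner points at distance `1/(k+1)` is the only one
of its size with this minimum distance. -/
theorem eq_codeVertex_of_acyclic [Finite V] [Finite E]
    (hG : ∀ (n : ℕ) (c : Fin (n + 1) → E × Bool), ¬ G.IsCycle c) {k : ℕ} (hk : 1 ≤ k)
    {D : Set G.Point} (hcard : D.encard = (G.codeVertex k).encard)
    (hsep : ENNReal.ofReal (1 / (k + 1 : ℕ)) ≤ D.einfsep) : G.codeVertex k = D := by
  classical
  have := Fintype.ofFinite E
  rw [encard_codeVertex] at hcard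
  have hD : D.Finite := Set.finite_of_encard_eq_coe hcard
  have hN : D.ncard = Nat.card V + k * Nat.card E := by rw [Set.ncard_def, hcard]; rfl
  rw [ncard_eq_sum hD] at hN
  set S := G.vertices D with hS
  let F : Set E := {e | (G.fiber D e).ncard = k + 1}
  have hle := fun e => fiber_ncard_le (K := k + 1) (by omega) hD hsep e
  have hF : ∀ e ∈ F, G.src e ∈ Sᶜ ∧ G.tgt e ∈ Sᶜ := by
    intro e he
    have he : (G.fiber D e).ncard = k + 1 := he
    constructor
    · intro h
      have := (hle e).2 (Or.inl h)
      omega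
    · intro h
      have := (hle e).2 (Or.inr h)
      omega
  have hsum : ∑ e, (G.fiber D e).ncard ≤ k * Nat.card E + F.ncard := by
    calc ∑ e, (G.fiber D e).ncard ≤ ∑ e, (k + if e ∈ F then 1 else 0) := by
          refine Finset.sum_le_sum fun e _ => ?_
          split_ifs with he
          · exact (hle e).1
          · have := (hle e).1
            have he : (G.fiber D e).ncard ≠ k + 1 := he
            omega
      _ = k * Nat.card E + F.ncard := by
          rw [Finset.sum_add_distrib, Finset.sum_const, Finset.card_univ, smul_eq_mul, mul_comm,
            Nat.card_eq_fintype_card, Finset.sum_boole, Set.ncard_eq_toFinset_card']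
          simp
  -- The surplus `F` is a set of edges of a forest on the complement of `S`, hence too small to make
  -- up for the missing vertices.
  have hSV : S = Set.univ := by
    by_contra hne
    have hlt := G.card_edges_lt hG (Set.nonempty_compl.2 hne) (fun e he => (hF e he).1)
      (fun e he => (hF e he).2)
    have := Set.ncard_add_ncard_compl S
    omega
  have hmem : ∀ v, v ∈ G.vertices D := fun v => by rw [← hS, hSV]; exact Set.mem_univ v
  have hle' : ∀ e ∈ Finset.univ, (G.fiber D e).ncard ≤ k := by
    intro e _
    have := (hle e).2 (Or.inl (hmem _))
    omega
  have hall : ∀ e, (G.fiber D e).ncard = k := by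
    have : ∑ e, (G.fiber D e).ncard = ∑ e : E, k := by
      rw [hSV, Set.ncard_univ] at hN
      rw [Finset.sum_const, Finset.card_univ, smul_eq_mul, ← Nat.card_eq_fintype_card, mul_comm]
      omega
    exact fun e => (Finset.sum_eq_sum_iff_of_le hle').1 this e (Finset.mem_univ e)
  refine hD.eq_of_subset_of_encard_le' ?_ (hcard.trans (G.encard_codeVertex k).symm).le
  rintro _ (⟨v, rfl⟩ | ⟨e, i, hi, hi', rfl⟩)
  · exact hmem v
  -- The `k` points lie between `1/(k+1)` and `1 - 1/(k+1)`, which leaves exactly the room for `k -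
  -- 1` gaps of length `1/(k+1)`.
  · have hb := (fiber_bound hD hsep e (j := k - 1) (by rw [hall e]; omega)
      (fun t ht => ⟨le_of_src_mem hsep ht (hmem _),
        le_of_tgt_mem hsep ht (hmem _)⟩)).2 (by
          rw [Nat.cast_sub hk]; push_cast; field_simp; linarith) (i - 1) (by omega)
    convert hb using 2
    rw [Nat.cast_sub hi]
    push_cast
    field_simp
    ring

theorem isUniqueOptimalCode_codeVertex_of_isTree [Finite V] [Finite E] (hG : G.IsTree) {k : ℕ}
    (hk : 1 ≤ k) : IsUniqueOptimalCode (G.codeVertex k) := by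
  refine isUniqueOptimalCode_of_forall (Set.finite_of_encard_eq_coe (G.encard_codeVertex k))
    (G.le_einfsep_codeVertex k) fun D hD hsep => ⟨IsometryEquiv.refl _, ?_⟩
  exact (Set.image_id _).trans (eq_codeVertex_of_acyclic hG.2 hk hD hsep)

end Forest

end UnitGraph

/-- If all sums of two distinct terms are nonnegative, so is the total sum `S`, and even
`S + (n - 2) β i`, where `n` is the number of terms. -/
theorem Finset.sum_add_nonneg_of_pairwise {ι : Type*} {s : Finset ι} {β : ι → ℝ}
    (h : ∀ i ∈ s, ∀ j ∈ s, i ≠ j → 0 ≤ β i + β j) {i : ι} (hi : i ∈ s) :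
    0 ≤ ∑ j ∈ s, β j + ((s.card : ℝ) - 2) * β i := by
  classical
  have h1 : 0 ≤ ∑ j ∈ s.erase i, (β i + β j) := Finset.sum_nonneg fun j hj =>
    h i hi j (Finset.mem_of_mem_erase hj) (Finset.ne_of_mem_erase hj).symm
  rw [Finset.sum_add_distrib, Finset.sum_const, Finset.card_erase_of_mem hi, nsmul_eq_mul,
    Nat.cast_sub (Finset.card_pos.2 ⟨i, hi⟩)] at h1
  have h2 := Finset.add_sum_erase s β hi
  push_cast at h1
  linarith

/-- Summing the inequality for `S + (n - 2) β i` over all `i` gives `(2n - 2) S ≥ 0`. -/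
theorem Finset.sum_nonneg_of_pairwise {ι : Type*} {s : Finset ι} {β : ι → ℝ}
    (h : ∀ i ∈ s, ∀ j ∈ s, i ≠ j → 0 ≤ β i + β j) (hs : 2 ≤ s.card) : 0 ≤ ∑ j ∈ s, β j := by
  have h1 : 0 ≤ ∑ i ∈ s, (∑ j ∈ s, β j + ((s.card : ℝ) - 2) * β i) :=
    Finset.sum_nonneg fun i hi => Finset.sum_add_nonneg_of_pairwise h hi
  rw [Finset.sum_add_distrib, ← Finset.mul_sum, Finset.sum_const, nsmul_eq_mul, ← add_mul] at h1
  have h2 : (2 : ℝ) ≤ s.card := by exact_mod_cast hs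
  exact nonneg_of_mul_nonneg_right h1 (by linarith)

/-! ### Uniqueness of the code without vertices when some vertex branches -/

namespace UnitGraph

variable {V E : Type*} {G : UnitGraph V E}

theorem degree_eq_sum [Fintype E] [DecidableEq V] (v : V) :
    G.degree v = ∑ e, ((if G.src e = v then 1 else 0) + if G.tgt e = v then 1 else 0) := by
  rw [Finset.sum_add_distrib, Finset.sum_boole, Finset.sum_boole, degree,
    Set.ncard_eq_toFinset_card', Set.ncard_eq_toFinset_card']
  simp

/-- If all degrees are at least two and one is larger, then a code with `k` points per edge and
minimum distance `1/k` contains no vertex. -/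
theorem vertices_eq_empty [Finite V] [Fintype E] (hG : G.Connected) (hdeg : ∀ v, 2 ≤ G.degree v)
    {v₀ : V} (hv₀ : 3 ≤ G.degree v₀) {k : ℕ} (hk : 1 ≤ k) {D : Set G.Point} (hD : D.Finite)
    (hcard : D.ncard = k * Nat.card E) (hsep : ENNReal.ofReal (1 / k) ≤ D.einfsep) :
    G.vertices D = ∅ := by
  classical
  have := Fintype.ofFinite V
  rw [ncard_eq_sum hD] at hcard
  set S := G.vertices D with hS
  by_contra hne
  obtain ⟨v, hv⟩ := Set.nonempty_iff_ne_empty.2 hne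
  -- The chain `2|S| ≤ ∑ deg = ∑ w ≤ 2 ∑ w' ≤ 2|S|`, whose last part comes from the size of `D`, is
  -- tight. Hence the vertices of `S` have degree two, and an edge has both ends in `S` or none.
  let w : E → ℕ := fun e => (if G.src e ∈ S then 1 else 0) + if G.tgt e ∈ S then 1 else 0
  let w' : E → ℕ := fun e => if G.src e ∈ S ∨ G.tgt e ∈ S then 1 else 0
  have hww : ∀ e ∈ Finset.univ, w e ≤ 2 * w' e := by
    intro e _
    simp only [w, w']
    by_cases h1 : G.src e ∈ S <;> by_cases h2 : G.tgt e ∈ S <;> simp [h1, h2]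
  have hw : ∑ v ∈ S.toFinset, G.degree v = ∑ e, w e := by
    simp only [degree_eq_sum, w]
    rw [Finset.sum_comm]
    refine Finset.sum_congr rfl fun e _ => ?_
    simp [Finset.sum_add_distrib]
  have hle : ∑ e, ((G.fiber D e).ncard + w' e) ≤ ∑ e : E, k := by
    refine Finset.sum_le_sum fun e _ => ?_
    have := fiber_ncard_le hk hD hsep e
    simp only [w']
    split_ifs with h
    · exact this.2 h
    · exact this.1
  rw [Finset.sum_add_distrib, Finset.sum_const, Finset.card_univ, smul_eq_mul,
    ← Nat.card_eq_fintype_card, mul_comm] at hle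
  have hdeg' : ∑ v ∈ S.toFinset, 2 ≤ ∑ v ∈ S.toFinset, G.degree v :=
    Finset.sum_le_sum fun v _ => hdeg v
  have h2 : ∑ v ∈ S.toFinset, 2 = 2 * S.ncard := by
    rw [Finset.sum_const, smul_eq_mul, mul_comm, Set.ncard_eq_toFinset_card']
  have hww' := Finset.sum_le_sum hww
  have h3 : ∑ e, 2 * w' e = 2 * ∑ e, w' e := by rw [Finset.mul_sum]
  have heq : ∑ e, w e = ∑ e, 2 * w' e := by omega
  have hedge : ∀ e, w e = 2 * w' e := fun e =>
    (Finset.sum_eq_sum_iff_of_le hww).1 heq e (Finset.mem_univ e)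
  have hiff : ∀ e, G.src e ∈ S ↔ G.tgt e ∈ S := by
    intro e
    have := hedge e
    simp only [w, w'] at this
    by_cases h1 : G.src e ∈ S <;> by_cases h2 : G.tgt e ∈ S <;> simp [h1, h2] at this ⊢
  have hmem : v₀ ∈ S := hG.forall_of_exists (P := fun v => v ∈ S) (fun d hd => by
    obtain ⟨e, b⟩ := d
    cases b
    · exact (hiff e).2 hd
    · exact (hiff e).1 hd) hv v₀
  have := (Finset.sum_eq_sum_iff_of_le (fun v _ => hdeg v)).1
    (by omega : ∑ v ∈ S.toFinset, 2 = ∑ v ∈ S.toFinset, G.degree v) v₀ (by simpa using hmem)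
  omega

theorem eq_codeOdd_of_branching [Finite V] [Finite E] (hG : G.Connected)
    (hdeg : ∀ v, 2 ≤ G.degree v) {v₀ : V} (hv₀ : 3 ≤ G.degree v₀) {k : ℕ} (hk : 1 ≤ k)
    {D : Set G.Point} (hcard : D.encard = (G.codeOdd k).encard)
    (hsep : ENNReal.ofReal (1 / k) ≤ D.einfsep) : G.codeOdd k = D := by
  classical
  have := Fintype.ofFinite E
  have := Fintype.ofFinite V
  have hk' : (0 : ℝ) < k := by exact_mod_cast hk
  have hcard' := hcard
  rw [encard_codeOdd] at hcard'
  have hD : D.Finite := Set.finite_of_encard_eq_coe hcard'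
  have hN : D.ncard = k * Nat.card E := by rw [Set.ncard_def, hcard']; rfl
  have hS := vertices_eq_empty hG hdeg hv₀ hk hD hN hsep
  rw [ncard_eq_sum hD, hS, Set.ncard_empty, zero_add] at hN
  have hall : ∀ e, (G.fiber D e).ncard = k := by
    have : ∑ e, (G.fiber D e).ncard = ∑ e : E, k := by
      rw [Finset.sum_const, Finset.card_univ, smul_eq_mul, ← Nat.card_eq_fintype_card, mul_comm, hN]
    exact fun e => (Finset.sum_eq_sum_iff_of_le
      fun e _ => (fiber_ncard_le hk hD hsep e).1).1 this e (Finset.mem_univ e)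
  choose a ha b hb hab using fun e => exists_fiber_bounds (e := e) hD
    (Set.nonempty_of_ncard_ne_zero (by rw [hall e]; omega))
  have hbound := fun e => fiber_bound hD hsep e (j := k - 1) (by rw [hall e]; omega) (hab e)
  have hk1 : ((k - 1 : ℕ) : ℝ) * (1 / k) = 1 - 1 / k := by
    rw [Nat.cast_sub hk]
    push_cast
    field_simp
  simp only [hk1] at hbound
  -- The distance along `d` from its start to the first point of `D`.
  let α : E × Bool → ℝ := fun d => if d.2 then a d.1 else 1 - b d.1
  have hα : ∀ d, 0 < α d ∧ α d < 1 := by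
    rintro ⟨e, _ | _⟩
    · have h1 := (hb e).1
      have h2 := (hb e).2.1
      exact ⟨by simp [α]; linarith, by simp [α]; linarith⟩
    · exact ⟨(ha e).1, (ha e).2.1⟩
  have hαmem : ∀ d, α d ∈ Set.Icc (0 : ℝ) 1 := fun d => ⟨(hα d).1.le, (hα d).2.le⟩
  have hαD : ∀ d, G.dpt d (α d) ∈ D := by
    rintro ⟨e, _ | _⟩
    · simpa [α, dpt] using (hb e).2.2
    · exact (ha e).2.2
  have hαrev : ∀ d, α d + α (rev d) ≤ 1 / k := by
    rintro ⟨e, _ | _⟩ <;> simp only [α, rev, Bool.not_true, Bool.not_false, if_true,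
      Bool.false_eq_true, if_false] <;> linarith [(hbound e).1]
  have hαstar : ∀ d d', G.start d = G.start d' → d ≠ d' → 1 / k ≤ α d + α d' := by
    intro d d' hst hne
    -- The two first points coincide only if `d` and `d'` are the two directions of a loop holding
    -- one point; then the distances add up to `1`.
    by_cases heq : G.dpt d (α d) = G.dpt d' (α d')
    · have h1 : 1 / (k : ℝ) ≤ 1 := by
        rw [div_le_one hk']
        exact_mod_cast hk
      refine h1.trans_eq ?_
      obtain ⟨e, β⟩ := d
      obtain ⟨e', β'⟩ := d'
      have h1 := (ha e).1
      have h2 := (ha e).2.1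
      have h3 := (hb e).1
      have h4 := (hb e).2.1
      have h1' := (ha e').1
      have h2' := (ha e').2.1
      have h3' := (hb e').1
      have h4' := (hb e').2.1
      cases β <;> cases β' <;> simp only [α, dpt, if_true, Bool.false_eq_true, if_false,
        sub_sub_cancel] at heq ⊢ <;> rw [pt_inj _ ‹_› ‹_› ‹_› ‹_›] at heq <;> obtain ⟨rfl, h⟩ := heq
      · exact absurd rfl hne
      · rw [h]; ring
      · rw [h]; ring
      · exact absurd rfl hne
    · exact le_of_edist_le hsep (hαD d) (hαD d') heq (add_nonneg (hαmem d).1 (hαmem d').1)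
        (G.edist_dpt_dpt_le hst (hαmem d) (hαmem d'))
  let β : E × Bool → ℝ := fun d => α d - 1 / (2 * k)
  have hhalf : 1 / (2 * k : ℝ) + 1 / (2 * k) = 1 / k := by field_simp; norm_num
  have hβrev : ∀ d ∈ Finset.univ, β d + β (rev d) ≤ 0 := fun d _ => by
    simp only [β]
    linarith [hαrev d]
  let star : V → Finset (E × Bool) := fun v => Finset.univ.filter fun d => G.start d = v
  have hstar : ∀ v, (star v).card = G.degree v := fun v => by
    rw [degree_eq, Set.ncard_eq_toFinset_card']
    simp [star]
  have hβstar : ∀ v, ∀ i ∈ star v, ∀ j ∈ star v, i ≠ j → 0 ≤ β i + β j := by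
    intro v i hi j hj hij
    simp only [star, Finset.mem_filter, Finset.mem_univ, true_and] at hi hj
    simp only [β]
    linarith [hαstar i j (hi.trans hj.symm) hij]
  -- The total of `β` is nonnegative when grouped by vertices and nonpositive when grouped by edges,
  -- so every group sums to zero.
  have hsum : ∑ v, ∑ d ∈ star v, β d = ∑ d, β d := Finset.sum_fiberwise _ _ _
  have hsumrev : ∑ d, β (rev d) = ∑ d, β d :=
    Equiv.sum_comp (Function.Involutive.toPerm rev rev_rev) β
  have hpos : ∀ v ∈ Finset.univ, 0 ≤ ∑ d ∈ star v, β d := fun v _ =>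
    Finset.sum_nonneg_of_pairwise (hβstar v) (by rw [hstar]; exact hdeg v)
  have hneg := Finset.sum_nonpos hβrev
  have hpos' := Finset.sum_nonneg hpos
  rw [Finset.sum_add_distrib, hsumrev] at hneg
  have hv := (Finset.sum_eq_zero_iff_of_nonneg hpos).1 (by linarith)
  have hr := (Finset.sum_eq_zero_iff_of_nonpos hβrev).1 (by
    rw [Finset.sum_add_distrib, hsumrev]
    linarith)
  have hβ0 : ∀ v, ∀ d, G.start d = v → β d = 0 := by
    -- A zero passes to the other end of its edge, where pairwise nonnegativity makes the whole star
    -- nonnegative with sum zero. At `v₀` the star is nonnegative because `(deg - 2) β ≥ 0` with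
    -- `deg > 2`.
    refine hG.forall_of_exists (v := v₀) (fun d hd => ?_) ?_
    · have h1 : β (rev d) = 0 := by linarith [hr d (Finset.mem_univ d), hd d rfl]
      have h2 : ∀ d' ∈ star (G.finish d), 0 ≤ β d' := by
        intro d' hd'
        by_cases hne : d' = rev d
        · rw [hne, h1]
        · have := hβstar _ d' hd' (rev d) (by simp [star]) hne
          linarith
      have := (Finset.sum_eq_zero_iff_of_nonneg h2).1 (hv _ (Finset.mem_univ _))
      exact fun d' hd' => this d' (by simp [star, hd'])
    · have h2 : ∀ d ∈ star v₀, 0 ≤ β d := by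
        intro d hd
        have := Finset.sum_add_nonneg_of_pairwise (hβstar v₀) hd
        rw [hv _ (Finset.mem_univ _), zero_add, hstar] at this
        have h3 : (3 : ℝ) ≤ G.degree v₀ := by exact_mod_cast hv₀
        exact nonneg_of_mul_nonneg_right this (by linarith)
      have := (Finset.sum_eq_zero_iff_of_nonneg h2).1 (hv _ (Finset.mem_univ _))
      exact fun d' hd' => this d' (by simp [star, hd'])
  refine hD.eq_of_subset_of_encard_le' ?_ hcard.le
  rintro _ ⟨e, i, hi, rfl⟩
  have h1 : a e - 1 / (2 * k) = 0 := hβ0 _ (e, true) rfl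
  have h2 : 1 - b e - 1 / (2 * k) = 0 := hβ0 _ (e, false) rfl
  have := (hbound e).2 (by linarith) i (by omega)
  convert this using 2
  rw [show a e = 1 / (2 * k) by linarith]
  field_simp
  ring

theorem isUniqueOptimalCode_codeOdd_of_branching [Finite V] [Finite E] (hG : G.Connected)
    (hdeg : ∀ v, 2 ≤ G.degree v) {v₀ : V} (hv₀ : 3 ≤ G.degree v₀) {k : ℕ} (hk : 1 ≤ k) :
    IsUniqueOptimalCode (G.codeOdd k) := by
  refine isUniqueOptimalCode_of_forall (Set.finite_of_encard_eq_coe (G.encard_codeOdd k))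
    (G.le_einfsep_codeOdd hk) fun D hD hsep => ⟨IsometryEquiv.refl _, ?_⟩
  exact (Set.image_id _).trans (eq_codeOdd_of_branching hG hdeg hv₀ hk hD hsep)

end UnitGraph

namespace UnitGraph

/-! ### Cycles as quotients of the line: rotations and equally spaced codes -/

section Cycle

variable {V E : Type*} (G : UnitGraph V E) {n : ℕ} (c : Fin (n + 1) → E × Bool)

/-- The traversed edges of a cycle, indexed periodically by the integers. -/
def periodic (z : ℤ) : E × Bool := c (show Fin (n + 1) from (z : ZMod (n + 1)))

/-- The real line wound around a cycle. -/
noncomputable def wind (x : ℝ) : G.Point := G.dpt (periodic c ⌊x⌋) (Int.fract x)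

variable {c}

theorem exists_periodic_eq (i : Fin (n + 1)) : ∃ z : ℤ, periodic c z = c i := by
  obtain ⟨z, hz⟩ := ZMod.intCast_surjective (n := n + 1) i
  exact ⟨z, congrArg c hz⟩

theorem periodic_add_mul (z w : ℤ) : periodic c (z + w * (n + 1)) = periodic c z := by
  refine congrArg c ?_
  have : ((n + 1 : ℕ) : ZMod (n + 1)) = 0 := ZMod.natCast_self _
  push_cast at this ⊢
  rw [this, mul_zero, add_zero]

variable {G}

theorem exists_eq_add_mul {z w : ℤ} (h : (z : ZMod (n + 1)) = w) :
    ∃ q : ℤ, z = w + q * (n + 1) := by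
  obtain ⟨q, hq⟩ := (ZMod.intCast_eq_intCast_iff_dvd_sub w z (n + 1)).1 h.symm
  exact ⟨q, by push_cast at hq; linarith⟩

theorem IsCycle.finish_periodic (hc : G.IsCycle c) (z : ℤ) :
    G.finish (periodic c z) = G.start (periodic c (z + 1)) := by
  unfold periodic
  rw [hc.1]
  push_cast
  rfl

theorem wind_add_mul (x : ℝ) (q : ℤ) : G.wind c (x + q * (n + 1)) = G.wind c x := by
  have h : x + q * (n + 1) = x + ((q * (n + 1) : ℤ) : ℝ) := by push_cast; rfl
  rw [wind, wind, h, Int.floor_add_intCast, Int.fract_add_intCast, periodic_add_mul]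

theorem IsCycle.wind_add (hc : G.IsCycle c) (z : ℤ) {t : ℝ} (ht : t ∈ Set.Icc (0 : ℝ) 1) :
    G.wind c (z + t) = G.dpt (periodic c z) t := by
  rcases ht.2.lt_or_eq with hlt | rfl
  · have hf : ⌊(z : ℝ) + t⌋ = z := by
      rw [Int.floor_eq_iff]
      exact ⟨by linarith [ht.1], by linarith⟩
    rw [wind, hf, Int.fract, hf, add_sub_cancel_left]
  · have : (z : ℝ) + 1 = ((z + 1 : ℤ) : ℝ) := by push_cast; rfl
    rw [dpt_one, hc.finish_periodic, this, wind, Int.floor_intCast, Int.fract_intCast, dpt_zero]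

theorem IsCycle.edist_wind_le (hc : G.IsCycle c) (x y : ℝ) :
    edist (G.wind c x) (G.wind c y) ≤ ENNReal.ofReal |x - y| := by
  -- Induction on a bound for the number of vertices passed between `x` and `y`.
  have key : ∀ (j : ℕ) (x y : ℝ), x ≤ y → ⌊y⌋ ≤ ⌊x⌋ + j →
      edist (G.wind c x) (G.wind c y) ≤ ENNReal.ofReal (y - x) := by
    intro j
    induction j with
    | zero =>
      intro x y hxy hj
      have hf : ⌊y⌋ = ⌊x⌋ := le_antisymm (by simpa using hj) (Int.floor_mono hxy)
      rw [wind, wind, hf]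
      refine (G.edist_dpt_le _ ⟨Int.fract_nonneg x, (Int.fract_lt_one x).le⟩
        ⟨Int.fract_nonneg y, (Int.fract_lt_one y).le⟩).trans_eq ?_
      rw [Int.fract, Int.fract, hf, sub_sub_sub_cancel_right, abs_sub_comm,
        abs_of_nonneg (by linarith)]
    | succ j ih =>
      intro x y hxy hj
      rcases le_or_gt y (⌊x⌋ + 1) with hy | hy
      · have hx : x = ⌊x⌋ + Int.fract x := (Int.floor_add_fract x).symm
        have hx0 := Int.fract_nonneg x
        have hy1 : y - ⌊x⌋ ∈ Set.Icc (0 : ℝ) 1 := ⟨by linarith, by linarith⟩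
        have h1 := hc.wind_add ⌊x⌋ hy1
        rw [add_sub_cancel] at h1
        rw [h1, wind]
        refine (G.edist_dpt_le _ ⟨hx0, (Int.fract_lt_one x).le⟩ hy1).trans_eq ?_
        rw [Int.fract, sub_sub_sub_cancel_right, abs_sub_comm, abs_of_nonneg (by linarith)]
      · have h1 : x ≤ ((⌊x⌋ + 1 : ℤ) : ℝ) := by push_cast; exact (Int.lt_floor_add_one x).le
        have h2 : ((⌊x⌋ + 1 : ℤ) : ℝ) ≤ y := by push_cast; exact hy.le
        have e2 := ih ((⌊x⌋ + 1 : ℤ) : ℝ) y h2 (by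
          rw [Int.floor_intCast]
          push_cast at hj
          linarith)
        have e1 : edist (G.wind c x) (G.wind c ((⌊x⌋ + 1 : ℤ) : ℝ)) ≤
            ENNReal.ofReal (((⌊x⌋ + 1 : ℤ) : ℝ) - x) := by
          have h3 := hc.wind_add ⌊x⌋ (t := 1) (by simp)
          push_cast at h1 ⊢
          rw [h3, wind]
          refine (G.edist_dpt_le _ ⟨Int.fract_nonneg x, (Int.fract_lt_one x).le⟩
            (by simp)).trans_eq ?_
          rw [Int.fract, abs_sub_comm, abs_of_nonneg (by linarith)]
          congr 1
          ring
        refine (edist_triangle _ _ _).trans ((add_le_add e1 e2).trans_eq ?_)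
        rw [← ENNReal.ofReal_add (by linarith) (by linarith)]
        congr 1
        ring
  rcases le_total x y with h | h
  · rw [abs_sub_comm, abs_of_nonneg (by linarith)]
    exact key (⌊y⌋ - ⌊x⌋).toNat x y h (by have := Int.floor_mono h; omega)
  · rw [edist_comm, abs_of_nonneg (by linarith)]
    exact key (⌊x⌋ - ⌊y⌋).toNat y x h (by have := Int.floor_mono h; omega)

theorem IsCycle.exists_of_wind_eq (hc : G.IsCycle c) {x y : ℝ} (h : G.wind c x = G.wind c y) :
    ∃ q : ℤ, x = y + q * (n + 1) := by
  have hpt : ∀ (d : E × Bool) (t : ℝ), 0 < t → t < 1 →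
      0 < (if d.2 then t else 1 - t) ∧ (if d.2 then t else 1 - t) < 1 := by
    intro d t h0 h1
    split_ifs
    · exact ⟨h0, h1⟩
    · exact ⟨by linarith, by linarith⟩
  have hx := Int.floor_add_fract x
  have hy := Int.floor_add_fract y
  suffices hs : Int.fract x = Int.fract y ∧ ((⌊x⌋ : ℤ) : ZMod (n + 1)) = (⌊y⌋ : ℤ) by
    obtain ⟨q, hq⟩ := exists_eq_add_mul hs.2
    refine ⟨q, ?_⟩
    rw [← hx, hq, hs.1]
    push_cast
    linarith
  unfold wind at h
  rcases (Int.fract_nonneg x).eq_or_lt with hx0 | hx0 <;>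
    rcases (Int.fract_nonneg y).eq_or_lt with hy0 | hy0
  · rw [← hx0, ← hy0, dpt_zero, dpt_zero, Point.vertex.injEq] at h
    exact ⟨by rw [← hx0, ← hy0], hc.2.2 h⟩
  · have := hpt (periodic c ⌊y⌋) _ hy0 (Int.fract_lt_one y)
    rw [← hx0, dpt_zero, dpt, G.pt_of_mem this.1 this.2] at h
    cases h
  · have := hpt (periodic c ⌊x⌋) _ hx0 (Int.fract_lt_one x)
    rw [← hy0, dpt_zero, dpt, G.pt_of_mem this.1 this.2] at h
    cases h
  · have h1 := hpt (periodic c ⌊x⌋) _ hx0 (Int.fract_lt_one x)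
    have h2 := hpt (periodic c ⌊y⌋) _ hy0 (Int.fract_lt_one y)
    rw [dpt, dpt, pt_inj _ h1.1 h1.2 h2.1 h2.2] at h
    have he : ((⌊x⌋ : ℤ) : ZMod (n + 1)) = (⌊y⌋ : ℤ) := hc.2.1 h.1
    have hd : periodic c ⌊x⌋ = periodic c ⌊y⌋ := congrArg c he
    refine ⟨?_, he⟩
    have h3 := h.2
    rw [hd] at h3
    split_ifs at h3 <;> linarith

theorem IsCycle.exists_wind_eq (hc : G.IsCycle c) (hE : Function.Surjective fun i => (c i).1)
    (e : E) : ∃ (z : ℤ) (b : Bool), ∀ t ∈ Set.Icc (0 : ℝ) 1,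
      G.wind c (z + if b then t else 1 - t) = G.pt e t := by
  obtain ⟨i, rfl⟩ := hE e
  obtain ⟨z, hz⟩ := exists_periodic_eq (c := c) i
  refine ⟨z, (c i).2, fun t ht => ?_⟩
  rw [hc.wind_add, hz, dpt]
  · congr 1
    split_ifs <;> ring
  · split_ifs
    · exact ht
    · exact ⟨by linarith [ht.2], by linarith [ht.1]⟩

theorem IsCycle.wind_surjective (hc : G.IsCycle c) (hE : Function.Surjective fun i => (c i).1)
    (hV : Function.Surjective fun i => G.start (c i)) : Function.Surjective (G.wind c) := by
  intro p
  obtain ⟨e, t, ht, rfl⟩ := G.exists_pt_eq (fun v => (hV v).imp' c fun _ h => h) p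
  obtain ⟨z, b, h⟩ := hc.exists_wind_eq hE e
  exact ⟨_, h t ht⟩

/-- The rotations of a cycle. -/
theorem IsCycle.exists_rotation (hc : G.IsCycle c) (hE : Function.Surjective fun i => (c i).1)
    (hV : Function.Surjective fun i => G.start (c i)) (s : ℝ) :
    ∃ g : G.Point ≃ᵢ G.Point, ∀ x, g (G.wind c x) = G.wind c (x + s) := by
  have hsurj := hc.wind_surjective hE hV
  -- The choice of the lift to the line is immaterial by periodicity. Each rotation is
  -- `1`-Lipschitz, and so is its inverse.
  let rot : ℝ → G.Point → G.Point := fun s p => G.wind c (Function.surjInv hsurj p + s)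
  have hrot : ∀ s x, rot s (G.wind c x) = G.wind c (x + s) := by
    intro s x
    obtain ⟨q, hq⟩ := hc.exists_of_wind_eq (Function.surjInv_eq hsurj (G.wind c x))
    simp only [rot]
    rw [hq, add_right_comm, wind_add_mul]
  have hle : ∀ s p q, edist (rot s p) (rot s q) ≤ edist p q := by
    intro s
    refine edist_map_le fun e x hx y hy => ?_
    obtain ⟨z, b, h⟩ := hc.exists_wind_eq hE e
    rw [← h x hx, ← h y hy, hrot, hrot]
    refine (hc.edist_wind_le _ _).trans_eq ?_
    rw [add_sub_add_right_eq_sub, add_sub_add_left_eq_sub]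
    split_ifs
    · rfl
    · rw [sub_sub_sub_cancel_left, abs_sub_comm]
  have hinv : ∀ s p, rot (-s) (rot s p) = p := by
    intro s p
    obtain ⟨x, rfl⟩ := hsurj p
    rw [hrot s x, hrot, add_neg_cancel_right]
  have hinv' : ∀ s p, rot s (rot (-s) p) = p := by
    intro s p
    simpa using hinv (-s) p
  refine ⟨⟨⟨rot s, rot (-s), hinv s, hinv' s⟩, fun p q => le_antisymm (hle s p q) ?_⟩, hrot s⟩
  have := hle (-s) (rot s p) (rot s q)
  rwa [hinv, hinv] at this

/-- On a cycle of length `n + 1`, a code with `K (n + 1)` points at distances at least `1/K` is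
equally spaced. -/
theorem IsCycle.exists_eq_image (hc : G.IsCycle c) (hE : Function.Surjective fun i => (c i).1)
    (hV : Function.Surjective fun i => G.start (c i)) {K : ℕ} (hK : 1 ≤ K) {D : Set G.Point}
    (hcard : D.encard = (K * (n + 1) : ℕ)) (hsep : ENNReal.ofReal (1 / K) ≤ D.einfsep) :
    ∃ x₀ : ℝ, D = (fun i : ℕ => G.wind c (x₀ + i * (1 / K))) '' Set.Iio (K * (n + 1)) := by
  have hK' : (0 : ℝ) < K := by exact_mod_cast hK
  have hn : (1 : ℝ) ≤ (n + 1 : ℝ) := by linarith [(Nat.cast_nonneg n : (0 : ℝ) ≤ n)]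
  have hKn : 1 ≤ K * (n + 1) := Nat.mul_pos hK (Nat.succ_pos n)
  have hsurj := hc.wind_surjective hE hV
  have hD : D.Finite := Set.finite_of_encard_eq_coe hcard
  have hne : D.Nonempty := by
    rw [← Set.encard_ne_zero, hcard]
    exact_mod_cast (by omega : K * (n + 1) ≠ 0)
  obtain ⟨_, hp⟩ := hne
  obtain ⟨x₀, rfl⟩ := hsurj ‹_›
  -- One period of lifts of `D`, starting at a lift of a point of `D`.
  let T : Set ℝ := {x | x ∈ Set.Ico x₀ (x₀ + (n + 1)) ∧ G.wind c x ∈ D}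
  have hinj : Set.InjOn (G.wind c) T := by
    intro x hx y hy h
    obtain ⟨q, hq⟩ := hc.exists_of_wind_eq h
    have h1 := hx.1.1
    have h2 := hx.1.2
    have h3 := hy.1.1
    have h4 := hy.1.2
    have hq0 : q = 0 := by
      have h5 : (q : ℝ) * (n + 1) < 1 * (n + 1) := by linarith
      have h6 : (-1 : ℝ) * (n + 1) < q * (n + 1) := by linarith
      have h7 : (q : ℝ) < 1 := lt_of_mul_lt_mul_right h5 (by linarith)
      have h8 : (-1 : ℝ) < q := lt_of_mul_lt_mul_right h6 (by linarith)
      have h9 : q < 1 := by exact_mod_cast h7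
      have h10 : -1 < q := by exact_mod_cast h8
      omega
    rw [hq, hq0]
    simp
  have himage : G.wind c '' T = D := by
    ext p
    constructor
    · rintro ⟨x, hx, rfl⟩
      exact hx.2
    · intro hp
      obtain ⟨x, rfl⟩ := hsurj p
      obtain ⟨q, hq, -⟩ := existsUnique_add_zsmul_mem_Ico (by linarith : (0 : ℝ) < n + 1) x x₀
      simp only [zsmul_eq_mul] at hq
      have := wind_add_mul (G := G) (c := c) x q
      exact ⟨_, ⟨hq, by rwa [this]⟩, this⟩
  have hTfin : T.Finite := Set.Finite.of_finite_image (himage ▸ hD) hinj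
  have hTcard : hTfin.toFinset.card = K * (n + 1) := by
    rw [← Set.ncard_eq_toFinset_card _ hTfin, ← hinj.ncard_image, himage,
      Set.ncard_def, hcard]
    rfl
  have hx₀ : x₀ ∈ T := ⟨⟨le_rfl, by linarith⟩, hp⟩
  have hsepT : ∀ x ∈ T, ∀ y ∈ T, x ≠ y → 1 / (K : ℝ) ≤ |x - y| := fun x hx y hy hxy =>
    le_of_edist_le hsep hx.2 hy.2 (hinj.ne hx hy hxy) (abs_nonneg _) (hc.edist_wind_le x y)
  -- The gap that closes the circle: `x₀ + (n + 1)` lifts the same point as `x₀`. Now `K (n + 1) -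
  -- 1` gaps fill the remaining interval exactly.
  have hupper : ∀ x ∈ T, x ≤ x₀ + (n + 1) - 1 / K := by
    intro x hx
    rcases eq_or_ne x x₀ with rfl | hne
    · have : 1 / (K : ℝ) ≤ 1 := by
        rw [div_le_one hK']
        exact_mod_cast hK
      linarith
    · have h1 := hx.1.2
      have h2 : G.wind c (x₀ + (n + 1)) = G.wind c x₀ := by
        simpa using wind_add_mul (G := G) (c := c) x₀ 1
      have h3 := hc.edist_wind_le x (x₀ + (n + 1))
      rw [h2] at h3
      have := le_of_edist_le hsep hx.2 hx₀.2 (hinj.ne hx hx₀ hne) (abs_nonneg _) h3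
      rw [abs_sub_comm, abs_of_nonneg (by linarith)] at this
      linarith
  have hgap := (separated_finset_real (δ := 1 / (K : ℝ)) (lo := x₀) (K * (n + 1) - 1)
    hTfin.toFinset (x₀ + (n + 1) - 1 / K) (by omega)
    (fun x hx => by
      have hx : x ∈ T := by simpa using hx
      exact ⟨hx.1.1, hupper x hx⟩)
    (fun x hx y hy => hsepT x (by simpa using hx) y (by simpa using hy))).2 (by
      rw [Nat.cast_sub hKn]
      push_cast
      field_simp
      linarith)
  have hmem : ∀ i ∈ Set.Iio (K * (n + 1)), x₀ + i * (1 / K) ∈ T := fun i hi => by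
    have hi : i < K * (n + 1) := hi
    simpa using hgap i (by omega)
  refine ⟨x₀, (hD.eq_of_subset_of_encard_le' ?_ ?_).symm⟩
  · rintro _ ⟨i, hi, rfl⟩
    exact (hmem i hi).2
  · rw [hcard, Set.InjOn.encard_image, ← Finset.coe_Iio, Set.encard_coe_eq_coe_finsetCard,
      Nat.card_Iio]
    · intro i hi j hj h
      have := hinj (hmem i hi) (hmem j hj) h
      have h2 : (i : ℝ) * (1 / K) = j * (1 / K) := by linarith
      exact_mod_cast mul_right_cancel₀ (by positivity) h2

theorem IsCycle.exists_isometry (hc : G.IsCycle c) (hE : Function.Surjective fun i => (c i).1)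
    (hV : Function.Surjective fun i => G.start (c i)) {K : ℕ} (hK : 1 ≤ K) {C D : Set G.Point}
    (hCcard : C.encard = (K * (n + 1) : ℕ)) (hC : ENNReal.ofReal (1 / K) ≤ C.einfsep)
    (hDcard : D.encard = (K * (n + 1) : ℕ)) (hD : ENNReal.ofReal (1 / K) ≤ D.einfsep) :
    ∃ g : G.Point ≃ᵢ G.Point, g '' C = D := by
  obtain ⟨x, rfl⟩ := hc.exists_eq_image hE hV hK hCcard hC
  obtain ⟨y, rfl⟩ := hc.exists_eq_image hE hV hK hDcard hD
  obtain ⟨g, hg⟩ := hc.exists_rotation hE hV (y - x)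
  refine ⟨g, ?_⟩
  rw [Set.image_image]
  refine Set.image_congr fun i _ => ?_
  rw [hg]
  congr 1
  ring

theorem isUniqueOptimalCode_codeOdd_of_isCycleGraph [Finite E] (hG : G.IsCycleGraph) {k : ℕ}
    (hk : 1 ≤ k) : IsUniqueOptimalCode (G.codeOdd k) := by
  obtain ⟨n, c, hc, hE, hV⟩ := hG
  have hcard : (G.codeOdd k).encard = (k * (n + 1) : ℕ) := by
    rw [encard_codeOdd, ← Nat.card_congr (Equiv.ofBijective _ ⟨hc.2.1, hE⟩), Nat.card_fin]
  exact isUniqueOptimalCode_of_forall (Set.finite_of_encard_eq_coe hcard) (G.le_einfsep_codeOdd hk)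
    fun D hD hsep => hc.exists_isometry hE hV hk hcard (G.le_einfsep_codeOdd hk) (hD.trans hcard)
      hsep

theorem isUniqueOptimalCode_codeVertex_of_isCycleGraph [Finite V] [Finite E]
    (hG : G.IsCycleGraph) (k : ℕ) : IsUniqueOptimalCode (G.codeVertex k) := by
  obtain ⟨n, c, hc, hE, hV⟩ := hG
  have hcard : (G.codeVertex k).encard = ((k + 1) * (n + 1) : ℕ) := by
    rw [encard_codeVertex, ← Nat.card_congr (Equiv.ofBijective _ ⟨hc.2.1, hE⟩), Nat.card_fin,
      ← Nat.card_congr (Equiv.ofBijective _ ⟨hc.2.2, hV⟩), Nat.card_fin]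
    congr 1
    ring
  exact isUniqueOptimalCode_of_forall (Set.finite_of_encard_eq_coe hcard)
    (G.le_einfsep_codeVertex k)
    fun D hD hsep => hc.exists_isometry hE hV (Nat.le_add_left 1 k) hcard
      (G.le_einfsep_codeVertex k) (hD.trans hcard) hsep

end Cycle

end UnitGraph

namespace UnitGraph

/-! ### Small spheres detect degrees -/

section Spheres

variable {V E : Type*} (G : UnitGraph V E)

theorem dpt_inner {d : E × Bool} {t : ℝ} (h0 : 0 < t) (h1 : t < 1) :
    ∃ s h0 h1, G.dpt d t = .inner d.1 s h0 h1 ∧ s = if d.2 then t else 1 - t := by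
  refine ⟨_, ?_, ?_, G.pt_of_mem ?_ ?_, rfl⟩ <;> split_ifs <;> linarith

theorem dpt_injective {t : ℝ} (h0 : 0 < t) (h1 : t < 1 / 2) :
    Function.Injective fun d => G.dpt d t := by
  intro d d' h
  obtain ⟨s, _, _, h2, hs⟩ := G.dpt_inner (d := d) h0 (by linarith)
  obtain ⟨s', _, _, h2', hs'⟩ := G.dpt_inner (d := d') h0 (by linarith)
  simp only [h2, h2', Point.inner.injEq] at h
  obtain ⟨e, b⟩ := d
  obtain ⟨e', b'⟩ := d'
  obtain ⟨h, h'⟩ := h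
  simp only at h
  subst h
  cases b <;> cases b' <;> simp at hs hs' <;> first | rfl | (exfalso; linarith)

/-- The number of points at a small distance from a vertex is its degree. -/
theorem ncard_sphere_vertex [Finite E] (v : V) {ε : ℝ} (h0 : 0 < ε) (h1 : ε < 1 / 2) :
    {y : G.Point | edist (.vertex v) y = ENNReal.ofReal ε}.ncard = G.degree v := by
  obtain ⟨f, hv, hw, hinner, hdpt, hle⟩ := G.exists_dist_vertex v
  have hup : ∀ (d : E × Bool) (t : ℝ), G.start d = v → t ∈ Set.Icc (0 : ℝ) 1 →
      edist (.vertex v : G.Point) (G.dpt d t) ≤ ENNReal.ofReal t := by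
    rintro d t rfl ht
    have := G.edist_dpt_le d (s := 0) (by simp) ht
    rwa [dpt_zero, zero_sub, abs_neg, abs_of_nonneg ht.1] at this
  have : {y : G.Point | edist (.vertex v) y = ENNReal.ofReal ε} =
      (fun d => G.dpt d ε) '' {d | G.start d = v} := by
    ext y
    constructor
    · intro hy
      have hy : edist (.vertex v) y = ENNReal.ofReal ε := hy
      have hfy : |f y| ≤ ε := by
        have := hle (.vertex v) y
        rwa [hy, hv, zero_sub, abs_neg, ENNReal.ofReal_le_ofReal_iff h0.le] at this
      have hfy' := (abs_le.1 hfy).2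
      cases y with
      | vertex w =>
        exfalso
        by_cases hwv : w = v
        · subst hwv
          rw [edist_self] at hy
          exact (ENNReal.ofReal_pos.2 h0).ne hy
        · rw [hw w hwv] at hfy'
          linarith
      | inner e t h0' h1' =>
        obtain ⟨d, hd, hdt⟩ := hinner e t h0' h1' (by linarith)
        refine ⟨d, hd, ?_⟩
        have hf0 : 0 ≤ f (.inner e t h0' h1') := by
          -- At a negative parameter `dpt` would take a default value, which is a vertex.
          by_contra! hneg
          have : G.dpt d (f (.inner e t h0' h1')) = .vertex (if d.2 then G.src d.1 else
              G.tgt d.1) := by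
            unfold dpt pt
            split_ifs <;> first | rfl | linarith
          rw [this] at hdt
          cases hdt
        have h2 := hup d _ hd ⟨hf0, by linarith⟩
        rw [hdt, hy, ENNReal.ofReal_le_ofReal_iff hf0] at h2
        rw [← hdt]
        exact congrArg _ (le_antisymm h2 hfy')
    · rintro ⟨d, hd, rfl⟩
      refine le_antisymm (hup d ε hd ⟨h0.le, by linarith⟩) ?_
      have := hle (.vertex v) (G.dpt d ε)
      rwa [hv, hdpt d ε hd h0 h1, zero_sub, abs_neg, abs_of_pos h0] at this
  rw [this, Set.ncard_image_of_injective _ (G.dpt_injective h0 h1), degree_eq]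

/-- There are two points at a small distance from an inner point of an edge. -/
theorem ncard_sphere_inner {e : E} {s : ℝ} (h0 : 0 < s) (h1 : s < 1) {ε : ℝ} (hε : 0 < ε)
    (hs : ε < s) (hs' : ε < 1 - s) :
    {y : G.Point | edist (.inner e s h0 h1) y = ENNReal.ofReal ε}.ncard = 2 := by
  have hup : ∀ t ∈ Set.Icc (0 : ℝ) 1,
      edist (.inner e s h0 h1 : G.Point) (G.pt e t) ≤ ENNReal.ofReal |s - t| := by
    intro t ht
    rw [← G.pt_of_mem h0 h1]
    exact G.edist_pt_le e ⟨h0.le, h1.le⟩ ht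
  have hlow : ∀ r, 0 ≤ r → r ≤ s → r ≤ 1 - s → ∀ y : G.Point,
      (∀ t h0 h1, y = .inner e t h0 h1 → r ≤ |t - s|) →
      ENNReal.ofReal r ≤ edist (.inner e s h0 h1 : G.Point) y :=
    fun r hr hrs hrs' => G.le_edist_inner h0 h1 hr hrs hrs'
  have key : ∀ t h0' h1', |s - t| ≤ ε →
      edist (.inner e s h0 h1 : G.Point) (.inner e t h0' h1') = ENNReal.ofReal |s - t| := by
    intro t h0' h1' ht
    refine le_antisymm ?_ (hlow _ (abs_nonneg _) (by linarith) (by linarith) _ ?_)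
    · rw [← G.pt_of_mem h0' h1']
      exact hup t ⟨h0'.le, h1'.le⟩
    · intro t' _ _ h
      rw [Point.inner.injEq] at h
      rw [← h.2, abs_sub_comm]
  have h2 : |s - (s - ε)| = ε := by rw [sub_sub_cancel, abs_of_pos hε]
  have h3 : |s - (s + ε)| = ε := by rw [sub_add_cancel_left, abs_neg, abs_of_pos hε]
  have : {y : G.Point | edist (.inner e s h0 h1) y = ENNReal.ofReal ε} =
      {.inner e (s - ε) (by linarith) (by linarith),
        .inner e (s + ε) (by linarith) (by linarith)} := by
    ext y
    constructor
    · intro hy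
      have hy : edist (.inner e s h0 h1) y = ENNReal.ofReal ε := hy
      have hex : ∃ t h0' h1', y = .inner e t h0' h1' ∧ |s - t| ≤ ε := by
        by_contra! hno
        -- If `y` is not within `ε` along the edge, a tent of some height `r > ε` around the center
        -- separates it.
        obtain ⟨r, hr, hr'⟩ : ∃ r, ε < r ∧ r ≤ min s (1 - s) ∧
            ∀ t h0' h1', y = .inner e t h0' h1' → r ≤ |t - s| := by
          cases y with
          | vertex v => exact ⟨min s (1 - s), lt_min hs hs', le_rfl, fun _ _ _ h => by cases h⟩
          | inner e' t h0' h1' =>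
            by_cases he : e' = e
            · subst he
              refine ⟨min (min s (1 - s)) |t - s|, lt_min (lt_min hs hs') ?_, min_le_left _ _, ?_⟩
              · rw [abs_sub_comm]
                exact hno t h0' h1' rfl
              · intro t' _ _ h
                rw [Point.inner.injEq] at h
                rw [← h.2]
                exact min_le_right _ _
            · refine ⟨min s (1 - s), lt_min hs hs', le_rfl, fun _ _ _ h => ?_⟩
              rw [Point.inner.injEq] at h
              exact absurd h.1 he
        have := hlow r (by linarith) (hr'.1.trans (min_le_left _ _))
          (hr'.1.trans (min_le_right _ _)) y hr'.2
        rw [hy, ENNReal.ofReal_le_ofReal_iff hε.le] at this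
        linarith
      obtain ⟨t, h0', h1', rfl, ht⟩ := hex
      rw [key t h0' h1' ht, ENNReal.ofReal_eq_ofReal_iff (abs_nonneg _) hε.le] at hy
      rcases (abs_eq hε.le).1 hy with h | h
      · obtain rfl : t = s - ε := by linarith
        exact Or.inl rfl
      · obtain rfl : t = s + ε := by linarith
        exact Or.inr rfl
    · rintro (rfl | rfl)
      · show edist _ _ = _
        rw [key _ _ _ h2.le, h2]
      · show edist _ _ = _
        rw [key _ _ _ h3.le, h3]
  rw [this, Set.ncard_pair]
  rw [Ne, Point.inner.injEq]
  rintro ⟨-, h⟩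
  linarith

variable {G}

/-- An isometry preserves the number of points on a small sphere, which is the degree at a vertex
and two at an inner point. -/
theorem degree_eq_two_of_isometry [Finite E] (g : G.Point ≃ᵢ G.Point) {v : V} {e : E} {s : ℝ}
    {h0 : 0 < s} {h1 : s < 1} (h : g (.vertex v) = .inner e s h0 h1) : G.degree v = 2 := by
  obtain ⟨ε, hε, hlt⟩ := exists_between (lt_min (lt_min h0 (sub_pos.2 h1)) one_half_pos)
  obtain ⟨h2, h3⟩ := lt_min_iff.1 hlt
  obtain ⟨h2, h4⟩ := lt_min_iff.1 h2
  rw [← G.ncard_sphere_vertex v hε h3, ← G.ncard_sphere_inner h0 h1 hε h2 h4, ← h,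
    ← Set.ncard_image_of_injective _ g.injective]
  congr 1
  ext y
  obtain ⟨x, rfl⟩ := g.surjective y
  simp [g.injective.mem_set_image, g.edist_eq]

end Spheres

/-! ### Competing codes when the graph condition fails -/

section Converse

variable {V E : Type*} {G : UnitGraph V E}

theorem einfsep_codeVertex_le [Nonempty E] {k : ℕ} (hk : 1 ≤ k) :
    (G.codeVertex k).einfsep ≤ ENNReal.ofReal (1 / (k + 1 : ℕ)) := by
  obtain ⟨e⟩ := ‹Nonempty E›
  have hm := frac_mem le_rfl hk
  refine (Set.einfsep_le_edist_of_mem (x := (Point.vertex (G.src e) : G.Point))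
    (y := G.pt e ((1 : ℕ) / (k + 1))) (Or.inl ⟨_, rfl⟩) (Or.inr ⟨e, 1, le_rfl, hk, rfl⟩) ?_).trans ?_
  · rw [G.pt_of_mem hm.1 hm.2]
    exact fun h => by cases h
  · rw [← pt_zero]
    refine (G.edist_pt_le e (by simp) ⟨hm.1.le, hm.2.le⟩).trans_eq ?_
    rw [zero_sub, abs_neg, abs_of_pos hm.1]
    push_cast
    rfl

/-- A cycle gives `|V| + k|E| ≤ (k + 1)|E|`, so some subset of `codeOdd (k + 1)` has the right size.
It contains no vertex, so an isometry onto it forces all degrees to be two. -/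
theorem isTree_or_isCycleGraph [Finite V] [Finite E] (hG : G.Connected) {k : ℕ} (hk : 1 ≤ k)
    (hC : IsUniqueOptimalCode (G.codeVertex k)) : G.IsTree ∨ G.IsCycleGraph := by
  by_contra! hno
  obtain ⟨n, c, hc⟩ : ∃ (n : ℕ) (c : Fin (n + 1) → E × Bool), G.IsCycle c := by
    by_contra! h
    exact hno.1 ⟨hG, h⟩
  have : Nonempty E := ⟨(c 0).1⟩
  obtain ⟨v, hv⟩ : ∃ v, G.degree v ≠ 2 := by
    by_contra! h
    exact hno.2 (hG.isCycleGraph h)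
  have hcard := hG.card_le_of_isCycle hc
  obtain ⟨D, hD, hDcard⟩ : ∃ D ⊆ G.codeOdd (k + 1), D.encard = (G.codeVertex k).encard := by
    refine Set.exists_subset_encard_eq ?_
    rw [encard_codeOdd, encard_codeVertex]
    exact_mod_cast (by rw [add_mul, one_mul, add_comm]; omega :
      Nat.card V + k * Nat.card E ≤ (k + 1) * Nat.card E)
  obtain ⟨g, rfl⟩ := hC.exists_image_eq hDcard ((einfsep_codeVertex_le hk).trans
    ((G.le_einfsep_codeOdd (Nat.le_add_left 1 k)).trans (Set.einfsep_anti hD)))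
  obtain ⟨e, i, h0, h1, -, h⟩ :=
    G.codeOdd_inner (hD (Set.mem_image_of_mem g (Or.inl ⟨v, rfl⟩)))
  exact hv (degree_eq_two_of_isometry g h)

/-- The retraction which contracts a segment of length `r` at a leaf. -/
theorem exists_leaf_retraction {d : E × Bool} (hd : ∀ d', G.start d' = G.start d → d' = d) {r : ℝ}
    (hr : r ∈ Set.Icc (0 : ℝ) 1) : ∃ f : G.Point → G.Point,
      (∀ x y, edist (f x) (f y) ≤ edist x y) ∧
      (∀ t ∈ Set.Icc (0 : ℝ) 1, f (G.dpt d t) = G.dpt d (max r t)) ∧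
      ∀ e ≠ d.1, ∀ t ∈ Set.Icc (0 : ℝ) 1, f (G.pt e t) = G.pt e t := by
  classical
  let f : G.Point → G.Point := fun p => match p with
    | .vertex w => if w = G.start d then G.dpt d r else .vertex w
    | .inner e t h0 h1 =>
      if e = d.1 then G.dpt d (max r (if d.2 then t else 1 - t)) else .inner e t h0 h1
  -- The edge at a leaf is not a loop, as otherwise `rev d` would start there too.
  have hfin : G.finish d ≠ G.start d := fun h => rev_ne d (hd _ (by rw [start_rev, h]))
  have h1 : ∀ t ∈ Set.Icc (0 : ℝ) 1, f (G.dpt d t) = G.dpt d (max r t) := by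
    intro t ht
    rcases ht.1.eq_or_lt with rfl | h0
    · rw [dpt_zero, max_eq_left hr.1]
      simp [f]
    rcases ht.2.eq_or_lt with rfl | h1
    · rw [dpt_one, max_eq_right hr.2, dpt_one]
      simp [f, hfin]
    obtain ⟨s, h0', h1', hs, hs'⟩ := G.dpt_inner (d := d) h0 h1
    rw [hs]
    simp only [f, if_true]
    rw [hs']
    congr 2
    split_ifs <;> ring
  have h2 : ∀ e ≠ d.1, ∀ t ∈ Set.Icc (0 : ℝ) 1, f (G.pt e t) = G.pt e t := by
    intro e he t ht
    have hne : ∀ b, G.start (e, b) ≠ G.start d := fun b h => he (congrArg Prod.fst (hd _ h))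
    rcases ht.1.eq_or_lt with rfl | h0
    · rw [pt_zero]
      exact if_neg (hne true)
    rcases ht.2.eq_or_lt with rfl | h1
    · rw [pt_one]
      exact if_neg (hne false)
    rw [G.pt_of_mem h0 h1]
    exact if_neg he
  refine ⟨f, edist_map_le fun e s hs t ht => ?_, h1, h2⟩
  by_cases he : e = d.1
  · subst he
    have hu : ∀ u ∈ Set.Icc (0 : ℝ) 1, ∃ u' ∈ Set.Icc (0 : ℝ) 1,
        G.pt d.1 u = G.dpt d u' ∧ u' = if d.2 then u else 1 - u := by
      intro u hu
      refine ⟨_, ?_, ?_, rfl⟩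
      · split_ifs
        · exact hu
        · exact ⟨by linarith [hu.2], by linarith [hu.1]⟩
      · unfold dpt
        congr 1
        split_ifs <;> ring
    obtain ⟨s', hs', h3, hss'⟩ := hu s hs
    obtain ⟨t', ht', h4, htt'⟩ := hu t ht
    rw [h3, h4, h1 s' hs', h1 t' ht']
    refine (G.edist_dpt_le d ⟨hr.1.trans (le_max_left _ _), max_le hr.2 hs'.2⟩
      ⟨hr.1.trans (le_max_left _ _), max_le hr.2 ht'.2⟩).trans (ENNReal.ofReal_le_ofReal ?_)
    refine (abs_max_sub_max_le_max _ _ _ _).trans (max_le (by simp) ?_)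
    rw [hss', htt']
    split_ifs
    · rfl
    · rw [sub_sub_sub_cancel_left, abs_sub_comm]
  · rw [h2 e he s hs, h2 e he t ht]
    exact G.edist_pt_le e hs ht

/-- At a leaf, the nearest code point is replaced by the leaf itself. The retraction of the last
`1/(2k)` of the edge maps the new code injectively into the old one without increasing distances, so
the new code is no worse, yet it contains a vertex of degree one. -/
theorem two_le_degree [Finite V] [Finite E] [Nonempty E] (hG : G.Connected) {k : ℕ} (hk : 1 ≤ k)
    (hC : IsUniqueOptimalCode (G.codeOdd k)) (v : V) : 2 ≤ G.degree v := by
  classical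
  by_contra! hlt
  obtain ⟨d, rfl⟩ := hG.exists_start v
  have hd : ∀ d', G.start d' = G.start d → d' = d := by
    intro d' hd'
    rw [degree_eq] at hlt
    exact (Set.ncard_le_one_iff (s := {d' | G.start d' = G.start d}) (Set.toFinite _)).1
      (by omega) hd' rfl
  have hk' : (1 : ℝ) ≤ k := by exact_mod_cast hk
  have hr0 : 0 < 1 / (2 * k : ℝ) := by positivity
  have hr1 : 1 / (2 * k : ℝ) < 1 := by
    rw [div_lt_one (by positivity)]
    linarith
  obtain ⟨f, hf, hfd, hfe⟩ := exists_leaf_retraction hd (r := 1 / (2 * k : ℝ)) ⟨hr0.le, hr1.le⟩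
  set p := G.dpt d (1 / (2 * k : ℝ)) with hp
  have hpC : p ∈ G.codeOdd k := by
    obtain ⟨e, b⟩ := d
    -- Seen from its other end, the first point of an edge has index `k - 1`.
    cases b
    · refine ⟨e, k - 1, by omega, ?_⟩
      rw [hp, dpt, Nat.cast_sub hk]
      push_cast
      congr 1
      field_simp
      ring
    · exact ⟨e, 0, by omega, by rw [hp, dpt]; simp⟩
  have hfv : f (.vertex (G.start d)) = p := by
    have := hfd 0 (by simp)
    rwa [dpt_zero, max_eq_left hr0.le] at this
  have hfC : ∀ q ∈ G.codeOdd k, f q = q := by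
    rintro _ ⟨e, i, hi, rfl⟩
    have hm := odd_mem hi
    by_cases he : e = d.1
    · have hi' : (i : ℝ) + 1 ≤ k := by exact_mod_cast hi
      have hq : G.pt e ((2 * i + 1 : ℝ) / (2 * k)) =
          G.dpt d (if d.2 then (2 * i + 1 : ℝ) / (2 * k) else 1 - (2 * i + 1 : ℝ) / (2 * k)) := by
        rw [he, dpt]
        congr 1
        split_ifs <;> ring
      rw [hq, hfd, max_eq_right]
      · split_ifs
        · gcongr
          linarith [(Nat.cast_nonneg i : (0 : ℝ) ≤ i)]
        · rw [le_sub_iff_add_le, ← add_div, div_le_one (by positivity)]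
          linarith
      · split_ifs
        · exact ⟨hm.1.le, hm.2.le⟩
        · exact ⟨by linarith, by linarith⟩
    · exact hfe e he _ ⟨hm.1.le, hm.2.le⟩
  have hvC : .vertex (G.start d) ∉ G.codeOdd k := G.vertex_notMem_codeOdd k _
  let D : Set G.Point := insert (.vertex (G.start d)) (G.codeOdd k \ {p})
  have hcard : D.encard = (G.codeOdd k).encard := by
    rw [Set.encard_insert_of_notMem fun h => hvC h.1, Set.encard_sdiff_singleton_add_one hpC]
  have hfD : ∀ x ∈ D, f x ∈ G.codeOdd k := by
    rintro x (rfl | hx)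
    · rwa [hfv]
    · rw [hfC x hx.1]
      exact hx.1
  have hinj : Set.InjOn f D := by
    rintro x (rfl | hx) y (rfl | hy) h
    · rfl
    · rw [hfv, hfC y hy.1] at h
      exact absurd h.symm hy.2
    · rw [hfv, hfC x hx.1] at h
      exact absurd h hx.2
    · rwa [hfC x hx.1, hfC y hy.1] at h
  obtain ⟨g, hg⟩ := hC.exists_image_eq hcard (Set.le_einfsep fun x hx y hy hxy =>
    (Set.einfsep_le_edist_of_mem (hfD x hx) (hfD y hy) (hinj.ne hx hy hxy)).trans (hf x y))
  have hv : .vertex (G.start d) ∈ g '' G.codeOdd k := by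
    rw [hg]
    exact Set.mem_insert _ _
  obtain ⟨q, hq, hqv⟩ := hv
  obtain ⟨e, i, h0, h1, -, rfl⟩ := G.codeOdd_inner hq
  have := degree_eq_two_of_isometry g.symm (g.symm_apply_eq.2 hqv.symm)
  omega

end Converse

end UnitGraph

theorem theorem4p14 {V E : Type*} [Finite V] [Finite E] (G : UnitGraph V E) (hG : G.Connected)
    (k : ℕ) (hk : 1 ≤ k) :
    (IsUniqueOptimalCode (G.codeVertex k) ↔ G.IsTree ∨ G.IsCycleGraph) ∧
      (Nonempty E → (IsUniqueOptimalCode (G.codeOdd k) ↔ ∀ v : V, 2 ≤ G.degree v)) := by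
  refine ⟨⟨UnitGraph.isTree_or_isCycleGraph hG hk, ?_⟩, fun hE =>
    ⟨UnitGraph.two_le_degree hG hk, fun hdeg => ?_⟩⟩
  · rintro (h | h)
    · exact UnitGraph.isUniqueOptimalCode_codeVertex_of_isTree h hk
    · exact UnitGraph.isUniqueOptimalCode_codeVertex_of_isCycleGraph h k
  -- Without branching all degrees are two and the graph is a cycle, where uniqueness holds only up
  -- to rotation.
  · by_cases h : ∃ v, 3 ≤ G.degree v
    · obtain ⟨v, hv⟩ := h
      exact UnitGraph.isUniqueOptimalCode_codeOdd_of_branching hG hdeg hv hk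
    · push Not at h
      exact UnitGraph.isUniqueOptimalCode_codeOdd_of_isCycleGraph
        (hG.isCycleGraph fun v => by have := h v; have := hdeg v; omega) hk
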